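/- **Setting.** Let $\mathcal G=(\mathcal V,\mathcal E)$ be a finite directed (multi)graph, the multi-modal network, with free flow times $\bar t_e>0$ and capacities $\bar f_e>0$ on its links. There are finite sets of origins $i$, destinations $j$ (both located at vertices), trip purposes $r$, agent types $a$ and travel modes $m$; mode-dependent link costs $c_e^m\in\mathbb R$; for every $i,j,m$ a nonempty set $P_{ij}^m$, consisting of all simple paths from $i$ to $j$ that use only links open to mode $m$; parameters $\gamma_r>0$, $\alpha_a>0$, $\beta_{am}\in\mathbb R$; for every agent type a nonempty set $\mathcal M_a$ of available modes; productions $l_i^{ra}\ge 0$ and attractions $w_j^r\ge 0$ with $\sum_{i,a}l_i^{ra}=\sum_j w_j^r=:N_r$, and $N=\sum_r N_r$. For $t\in\mathbb R^{\mathcal E}$ put $$T_{ij}^m(t)=\min_{p\in P_{ij}^m}\sum_{e\in p}(t_e+c_e^m),\qquad T_{ij}^a(t)=-\tfrac1{\alpha_a}\ln\sum_{m\in\mathcal M_a}e^{-\alpha_aT_{ij}^m(t)-\beta_{am}},$$ $$\Pi=\Bigl\{d\ge 0:\ \sum_j d_{ij}^{ra}=l_i^{ra},\ \sum_{i,a}d_{ij}^{ra}=w_j^r\Bigr\},\qquad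 E(d,t)=\sum_{i,j,r,a}\Bigl(d_{ij}^{ra}T_{ij}^a(t)+\tfrac1{\gamma_r}d_{ij}^{ra}\ln d_{ij}^{ra}\Bigr),$$ $\varphi_3(t)=-\min_{d\in\Pi}E(d,t)$ and $D_3'(t)=-\varphi_3(t)-h(t)$ on $\operatorname{dom}h=\{t:\ t\ge\bar t\}$. For $d=(d_{ij}^{ram})$ with $d_{ij}^{ra}=\sum_m d_{ij}^{ram}$, and link flows $f=(f_e^m)$ with $f_e=\sum_m f_e^m$, put $$H(d)=\sum_{i,j,r,a}\tfrac1{\gamma_r}d_{ij}^{ra}\ln d_{ij}^{ra}+\sum_{i,j,r,a,m}\tfrac1{\alpha_a}d_{ij}^{ram}\Bigl(\ln\tfrac{d_{ij}^{ram}}{d_{ij}^{ra}}+\beta_{am}\Bigr),\qquad P_3(d,f)=\sum_e\Bigl(\sigma_e(f_e)+\sum_m c_e^mf_e^m\Bigr)+H(d),$$ with $0\ln 0=0$ and the terms with $d_{ij}^{ram}=0$ read as $0$. * *Beckmann model* (with $\rho,\mu>0$): $\sigma_e(f)=\int_0^{f}\bar t_e\bigl(1+\rho(z/\bar f_e)^{1/\mu}\bigr)\,dz$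 and $h(t)=\sum_e\sup_{f\ge 0}\{t_ef-\sigma_e(f)\}$. * *Stable Dynamics model*: $\sigma_e(f)=\bar t_ef$ and $h(t)=\langle t-\bar t,\bar f\rangle$. Let $M=\sqrt{2H_{\max}}\,N$, where $H_{\max}$ is the largest number of links of a simple path in $\mathcal G$; let $$\tilde R^2=\rho^2N^{2/\mu}\sum_e \bar t_e^{\,2}/\bar f_e^{\,2/\mu},$$ and let $\|\cdot\|$ be the Euclidean norm. **Algorithm (USTM).** Given $\varepsilon>0$ and $L_0>0$, set $t^0=u^0=\bar t$, $A_0=0$, $\phi_0(t)=\frac12\|t-\bar t\|^2$. In iteration $k=0,1,\dots$ the values $L_{k+1}=L_k/2,\ L_k,\ 2L_k,\dots$ are tried in turn. For each of them one computes $$\alpha_{k+1}=\tfrac1{2L_{k+1}}+\sqrt{\tfrac1{4L_{k+1}^2}+\tfrac{A_k}{L_{k+1}}},\qquad A_{k+1}=A_k+\alpha_{k+1},\qquad y^{k+1}=\frac{\alpha_{k+1}u^k+A_kt^k}{A_{k+1}},$$ $$u^{k+1}=\operatorname*{argmin}_{t\ge\bar t}\phi_{k+1}(t),\qquad t^{k+1}=\frac{\alpha_{k+1}u^{k+1}+A_kt^k}{A_{k+1}},$$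 where $\phi_{k+1}(t)=\phi_k(t)+\alpha_{k+1}\bigl[\tilde\Phi(y^{k+1})+\langle\tilde\nabla\Phi(y^{k+1}),t-y^{k+1}\rangle+h(t)\bigr]$. The first value is accepted for which $$\tilde\Phi(t^{k+1})\le\tilde\Phi(y^{k+1})+\langle\tilde\nabla\Phi(y^{k+1}),t^{k+1}-y^{k+1}\rangle+\tfrac{L_{k+1}}2\|t^{k+1}-y^{k+1}\|^2+\tfrac{\alpha_{k+1}}{2A_{k+1}}\varepsilon .$$ The oracle is inexact: at $s=y^{k+1}$ and at $s=t^{k+1}$ it returns an arbitrary $\tilde d(s)\in\Pi$ with $E(\tilde d(s),s)\le\min_{d\in\Pi}E(d,s)+\delta_k$, $\delta_k=\frac{\alpha_{k+1}\varepsilon}{4A_{k+1}}$, and $\tilde\Phi(s)=-E(\tilde d(s),s)$. At $y=y^{k+1}$ let $d'(y)$ be the modal split of $\tilde d(y)$, that is, $$d'(y)_{ij}^{ram}=\tilde d(y)_{ij}^{ra}\,\frac{e^{-\alpha_aT_{ij}^m(y)-\beta_{am}}}{\sum_{m'\in\mathcal M_a}e^{-\alpha_aT_{ij}^{m'}(y)-\beta_{am'}}}\quad(m\in\mathcal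 M_a),\qquad d'(y)_{ij}^{ram}=0\quad(m\notin\mathcal M_a),$$ and let $f^{k+1}=([f^{k+1}]_e^m)$ be any link flows obtained by sending the trips $d'(y)$ along shortest paths for the link costs $y_e+c_e^m$; then $[\tilde\nabla\Phi(y)]_e=-\sum_m[f^{k+1}]_e^m$. After $K\ge1$ iterations put $$\hat d^K=\frac1{A_K}\sum_{k=1}^K\alpha_kd'(y^k),\qquad \hat f^K=\frac1{A_K}\sum_{k=1}^K\alpha_kf^k .$$ **Theorem.** Assume $0<L_0\le M^2/\varepsilon$. 1. In the Beckmann model, for every integer $K\ge1$ with $K\ge4(M\tilde R/\varepsilon)^2$, after $K$ iterations $$0\le P_3(\hat d^K,\hat f^K)-D_3'(t^K)\le\varepsilon .$$ 2. In the Stable Dynamics model, let $t^*$ be any maximizer of $D_3'$ over $t\ge\bar t$ and let $R=\|t^*-\bar t\|$. For every integer $K\ge1$ with $K\ge4(MR/\varepsilon)^2$, after $K$ iterations $$0\le P_3(\hat d^K,\hat f^K)-D_3'(t^K)+\langle(\hat f^K-\bar f)_+,t^*-\bar t\rangle\le\varepsilon ,$$ and, if $R>0$, $\ \|(\hat f^K-\bar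 f)_+\|\le 2\varepsilon/R$; here $\hat f^K$ stands for the vector of total link flows $\sum_m[\hat f^K]_e^m$, and $(\cdot)_+$ is the componentwise positive part. -/

import Mathlib

noncomputable section

namespace TrafficUSTM

open scoped BigOperators

/-- Vectors indexed by the links of the network, with the Euclidean norm. -/
abbrev LinkVec (E : Type*) := EuclideanSpace ℝ E

/-- `p` is a walk (list of consecutive links) from `i` to `j` in the directed (multi)graph
with source and target maps `src`, `tgt`. -/
def IsWalk {V E : Type*} (src tgt : E → V) : V → V → List E → Prop
  | i, j, [] => i = j
  | i, j, e :: p => src e = i ∧ IsWalk src tgt (tgt e) j p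

/-- A simple path: a walk which visits no vertex twice. -/
def IsSimplePath {V E : Type*} (src tgt : E → V) (i j : V) (p : List E) : Prop :=
  IsWalk src tgt i j p ∧ (i :: p.map tgt).Nodup

/-- The 0-1 vector of the links used by `p`. -/
def incidence {E : Type*} (p : List E) : LinkVec E :=
  WithLp.toLp 2 (Set.indicator {e | e ∈ p} (fun _ => (1 : ℝ)))

/-- The data of the nested combined distribution / modal split / assignment model:
`V` vertices, `E` links, `O` origin zones, `D` destination zones, `Pu` trip purposes,
`Ag` agent types, `Mo` travel modes. -/
structure Model (V E O D Pu Ag Mo : Type*) [Fintype V] [Fintype E] [Fintype O] [Fintype D]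
    [Fintype Pu] [Fintype Ag] [Fintype Mo] where
  /-- tail of a link -/
  src : E → V
  /-- head of a link -/
  tgt : E → V
  /-- vertex (centroid) of an origin zone -/
  org : O → V
  /-- vertex (centroid) of a destination zone -/
  dst : D → V
  /-- links of the multi-modal network that the mode may use -/
  links : Mo → Set E
  /-- free flow times -/
  tbar : LinkVec E
  /-- link capacities -/
  fbar : LinkVec E
  /-- mode specific additional link costs -/
  c : Mo → E → ℝ
  /-- destination choice parameters -/
  γ : Pu → ℝ
  /-- mode choice parameters -/
  α : Ag → ℝ
  /-- mode choice parameters -/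
  β : Ag → Mo → ℝ
  /-- travel modes available to the agents of a given type -/
  nest : Ag → Finset Mo
  /-- productions -/
  l : Pu → Ag → O → ℝ
  /-- attractions -/
  w : Pu → D → ℝ
  tbar_pos : ∀ e, 0 < tbar e
  fbar_pos : ∀ e, 0 < fbar e
  γ_pos : ∀ r, 0 < γ r
  α_pos : ∀ a, 0 < α a
  nest_nonempty : ∀ a, (nest a).Nonempty
  l_nonneg : ∀ r a i, 0 ≤ l r a i
  w_nonneg : ∀ r j, 0 ≤ w r j
  balance : ∀ r, ∑ a, ∑ i, l r a i = ∑ j, w r j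
  path_exists : ∀ m i j, ∃ p, IsSimplePath src tgt (org i) (dst j) p ∧ ∀ e ∈ p, e ∈ links m

/-- Trips `d r a i j` by purpose, agent type, origin and destination. -/
abbrev Trips (O D Pu Ag : Type*) := Pu → Ag → O → D → ℝ

/-- Trips `d r a m i j` by purpose, agent type, mode, origin and destination. -/
abbrev ModeTrips (O D Pu Ag Mo : Type*) := Pu → Ag → Mo → O → D → ℝ

/-- Link flows `f m e` by mode. -/
abbrev ModeFlow (E Mo : Type*) := Mo → LinkVec E

/-- Total link flows `f e = ∑ m, f m e`. -/
def totalFlow {E Mo : Type*} [Fintype Mo] (f : ModeFlow E Mo) : LinkVec E := ∑ m, f m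

namespace Model

variable {V E O D Pu Ag Mo : Type*} [Fintype V] [Fintype E] [Fintype O] [Fintype D]
  [Fintype Pu] [Fintype Ag] [Fintype Mo] (P : Model V E O D Pu Ag Mo)

/-- The simple paths from `i` to `j` for mode `m`. -/
def paths (m : Mo) (i : O) (j : D) : Set (List E) :=
  {p | IsSimplePath P.src P.tgt (P.org i) (P.dst j) p ∧ ∀ e ∈ p, e ∈ P.links m}

/-- Cost of a path for mode `m` when link `e` costs `t e + c m e`. -/
def pathCost (m : Mo) (t : LinkVec E) (p : List E) : ℝ :=
  (p.map fun e => t e + P.c m e).sum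

/-- Shortest path costs by mode. -/
def T (t : LinkVec E) (m : Mo) (i : O) (j : D) : ℝ :=
  sInf (P.pathCost m t '' P.paths m i j)

/-- Composite (log-sum) travel costs by agent type. -/
def Tcomp (t : LinkVec E) (a : Ag) (i : O) (j : D) : ℝ :=
  -(1 / P.α a) * Real.log (∑ m ∈ P.nest a, Real.exp (-P.α a * P.T t m i j - P.β a m))

/-- The trip matrices with the prescribed productions and attractions. -/
def feasible : Set (Trips O D Pu Ag) :=
  {d | (∀ r a i j, 0 ≤ d r a i j) ∧ (∀ r a i, ∑ j, d r a i j = P.l r a i) ∧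
    ∀ r j, ∑ a, ∑ i, d r a i j = P.w r j}

/-- The entropy objective of the trip distribution subproblem for link times `t`. -/
def Ent (d : Trips O D Pu Ag) (t : LinkVec E) : ℝ :=
  (∑ r, ∑ a, ∑ i, ∑ j, d r a i j * P.Tcomp t a i j) +
    ∑ r, ∑ a, ∑ i, ∑ j, 1 / P.γ r * (d r a i j * Real.log (d r a i j))

/-- `d` is a `δ`-solution of the trip distribution subproblem for link times `t`. -/
def IsDeltaSol (δ : ℝ) (t : LinkVec E) (d : Trips O D Pu Ag) : Prop :=
  d ∈ P.feasible ∧ ∀ d' ∈ P.feasible, P.Ent d t ≤ P.Ent d' t + δ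

/-- `φ₃(t) = - min_d Ent(d, t)`. -/
def phi3 (t : LinkVec E) : ℝ :=
  -sInf ((fun d => P.Ent d t) '' P.feasible)

/-- The set of admissible link times `t ≥ t̄`. -/
def dom : Set (LinkVec E) := {t | ∀ e, P.tbar e ≤ t e}

/-- The dual objective, `h` being the composite term of the chosen assignment model. -/
def dual (h : LinkVec E → ℝ) (t : LinkVec E) : ℝ := -P.phi3 t - h t

open Classical in
/-- Logit modal split of the trips `d` for link times `t`. -/
def modalSplit (t : LinkVec E) (d : Trips O D Pu Ag) : ModeTrips O D Pu Ag Mo :=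
  fun r a m i j =>
    if m ∈ P.nest a then
      d r a i j * (Real.exp (-P.α a * P.T t m i j - P.β a m) /
        ∑ m' ∈ P.nest a, Real.exp (-P.α a * P.T t m' i j - P.β a m'))
    else 0

/-- The entropy term of the primal objective. -/
def H (d : ModeTrips O D Pu Ag Mo) : ℝ :=
  (∑ r, ∑ a, ∑ i, ∑ j, 1 / P.γ r *
      ((∑ m, d r a m i j) * Real.log (∑ m, d r a m i j))) +
    ∑ r, ∑ a, ∑ i, ∑ j, ∑ m, 1 / P.α a *
      (d r a m i j * (Real.log (d r a m i j / ∑ m', d r a m' i j) + P.β a m))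

/-- The network term of the primal objective, for link potentials `σ`. -/
def Psi (σ : E → ℝ → ℝ) (f : ModeFlow E Mo) : ℝ :=
  ∑ e, (σ e (totalFlow f e) + ∑ m, P.c m e * f m e)

/-- The primal objective. -/
def P3 (σ : E → ℝ → ℝ) (d : ModeTrips O D Pu Ag Mo) (f : ModeFlow E Mo) : ℝ :=
  P.Psi σ f + P.H d

/-! ### The two assignment models -/

/-- BPR link cost functions. -/
def bpr (ρ μ : ℝ) (e : E) (z : ℝ) : ℝ :=
  P.tbar e * (1 + ρ * (z / P.fbar e) ^ (1 / μ))

/-- Beckmann link potentials. -/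
def sigmaB (ρ μ : ℝ) (e : E) (z : ℝ) : ℝ := ∫ s in (0 : ℝ)..z, P.bpr ρ μ e s

/-- Composite term of the Beckmann model: the sum of the conjugates of the potentials. -/
def hB (ρ μ : ℝ) (t : LinkVec E) : ℝ :=
  ∑ e, sSup ((fun z => t e * z - P.sigmaB ρ μ e z) '' Set.Ici 0)

/-- Link potentials of the stable dynamics model. -/
def sigmaSD (e : E) (z : ℝ) : ℝ := z * P.tbar e

/-- Composite term of the stable dynamics model. -/
def hSD (t : LinkVec E) : ℝ := inner ℝ (t - P.tbar) P.fbar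

/-! ### Constants -/

/-- Total number of agents. -/
def N : ℝ := ∑ r, ∑ j, P.w r j

/-- Maximum number of links of a simple path in the network. -/
def maxLen : ℕ := sSup {n | ∃ i j p, IsSimplePath P.src P.tgt i j p ∧ p.length = n}

/-- `M = √(2H) N`. -/
def M : ℝ := Real.sqrt (2 * (P.maxLen : ℝ)) * P.N

/-- The constant `R̃` of the Beckmann model. -/
def Rtilde (ρ μ : ℝ) : ℝ :=
  Real.sqrt (ρ ^ 2 * P.N ^ (2 / μ) * ∑ e, P.tbar e ^ 2 / P.fbar e ^ (2 / μ))

/-! ### The universal method of similar triangles -/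

/-- The shortest paths from `i` to `j` for mode `m` and link times `t`. -/
def shortest (t : LinkVec E) (m : Mo) (i : O) (j : D) : Set (List E) :=
  {p | p ∈ P.paths m i j ∧ P.pathCost m t p = P.T t m i j}

/-- `f` is a vector of link flows (by mode) obtained by sending the trips `d` along shortest
paths for link times `t`, split between several shortest paths in any way. -/
def IsShortestFlow (t : LinkVec E) (d : ModeTrips O D Pu Ag Mo) (f : ModeFlow E Mo) : Prop :=
  ∃ v : Pu → Ag → Mo → O → D → LinkVec E,
    (∀ r a m i j, v r a m i j ∈ convexHull ℝ (incidence '' P.shortest t m i j)) ∧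
    ∀ m, f m = ∑ r, ∑ a, ∑ i, ∑ j, d r a m i j • v r a m i j

end Model

/-- The quantities kept between two iterations: `L_k`, `A_k`, `t^k`, `u^k`, `φ_k`. -/
structure State (E : Type*) where
  L : ℝ
  A : ℝ
  t : LinkVec E
  u : LinkVec E
  φ : LinkVec E → ℝ

/-- The quantities computed in one pass of the inner (line search) loop: `L_{k+1}`, `α_{k+1}`,
`A_{k+1}`, `y^{k+1}`, `u^{k+1}`, `t^{k+1}` and the answers of the inexact oracle, namely the
approximate trip matrices `dy`, `dt` at `y^{k+1}`, `t^{k+1}`, and link flows `fy` along the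
shortest paths at `y^{k+1}`. -/
structure Attempt (E O D Pu Ag Mo : Type*) where
  L : ℝ
  α : ℝ
  A : ℝ
  y : LinkVec E
  u : LinkVec E
  t : LinkVec E
  dy : Trips O D Pu Ag
  fy : ModeFlow E Mo
  dt : Trips O D Pu Ag

namespace Model

variable {V E O D Pu Ag Mo : Type*} [Fintype V] [Fintype E] [Fintype O] [Fintype D]
  [Fintype Pu] [Fintype Ag] [Fintype Mo] (P : Model V E O D Pu Ag Mo)

/-- The linear model `Φ̃(y) + ⟨∇̃Φ(y), t - y⟩` of the smooth part, where
`Φ̃(y) = - Ent(d̃(y), y)` and `∇̃Φ(y)` is minus the vector of total link flows. -/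
def linModel (a : Attempt E O D Pu Ag Mo) (t : LinkVec E) : ℝ :=
  -P.Ent a.dy a.y + inner ℝ (-totalFlow a.fy) (t - a.y)

/-- The estimating function `φ_{k+1}`. -/
def nextPhi (h : LinkVec E → ℝ) (s : State E) (a : Attempt E O D Pu Ag Mo)
    (t : LinkVec E) : ℝ :=
  s.φ t + a.α * (P.linModel a t + h t)

/-- `a` is a correct execution of the body of the inner loop with trial constant `L`, started
from the state `s`, the subproblems being solved with accuracy `α_{k+1} ε / (4 A_{k+1})`. -/
structure IsAttempt (h : LinkVec E → ℝ) (ε : ℝ) (s : State E) (L : ℝ)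
    (a : Attempt E O D Pu Ag Mo) : Prop where
  L_eq : a.L = L
  α_eq : a.α = 1 / (2 * L) + Real.sqrt (1 / (4 * L ^ 2) + s.A / L)
  A_eq : a.A = s.A + a.α
  y_eq : a.y = (1 / a.A) • (a.α • s.u + s.A • s.t)
  dy_sol : P.IsDeltaSol (a.α * ε / (4 * a.A)) a.y a.dy
  fy_flow : P.IsShortestFlow a.y (P.modalSplit a.y a.dy) a.fy
  u_mem : a.u ∈ P.dom
  u_min : IsMinOn (P.nextPhi h s a) P.dom a.u
  t_eq : a.t = (1 / a.A) • (a.α • a.u + s.A • s.t)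
  dt_sol : P.IsDeltaSol (a.α * ε / (4 * a.A)) a.t a.dt

/-- The stopping test of the inner loop. -/
def Accepted (ε : ℝ) (a : Attempt E O D Pu Ag Mo) : Prop :=
  -P.Ent a.dt a.t ≤ P.linModel a a.t + a.L / 2 * ‖a.t - a.y‖ ^ 2 + a.α / (2 * a.A) * ε

/-- `a` is the outcome of the inner loop started from `s`: the trial constants are
`L_k / 2, L_k, 2 L_k, …`, and `a` is the first attempt that passes the test. -/
def LineSearch (h : LinkVec E → ℝ) (ε : ℝ) (s : State E) (a : Attempt E O D Pu Ag Mo) : Prop :=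
  ∃ (n : ℕ) (b : ℕ → Attempt E O D Pu Ag Mo),
    (∀ q ≤ n, P.IsAttempt h ε s (s.L / 2 * 2 ^ q) (b q)) ∧
    (∀ q < n, ¬ P.Accepted ε (b q)) ∧ P.Accepted ε (b n) ∧ b n = a

/-- The state after `k` iterations started from `t^0 = t̄`, when `a k` is the accepted attempt
of iteration `k` (counted from `0`). -/
def state (h : LinkVec E → ℝ) (L₀ : ℝ) (a : ℕ → Attempt E O D Pu Ag Mo) : ℕ → State E
  | 0 => { L := L₀, A := 0, t := P.tbar, u := P.tbar, φ := fun t => 1 / 2 * ‖t - P.tbar‖ ^ 2 }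
  | k + 1 => { L := (a k).L, A := (a k).A, t := (a k).t, u := (a k).u,
               φ := P.nextPhi h (state h L₀ a k) (a k) }

/-- The first `K` iterations of the method. -/
def IsRun (h : LinkVec E → ℝ) (ε L₀ : ℝ) (K : ℕ) (a : ℕ → Attempt E O D Pu Ag Mo) : Prop :=
  ∀ k < K, P.LineSearch h ε (P.state h L₀ a k) (a k)

/-- The recovered trip matrix: the average of the `d'(y^k)` with weights `α_k / A_K`. -/
def dhat (h : LinkVec E → ℝ) (L₀ : ℝ) (a : ℕ → Attempt E O D Pu Ag Mo) (K : ℕ) :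
    ModeTrips O D Pu Ag Mo :=
  (1 / (P.state h L₀ a K).A) •
    ∑ k ∈ Finset.range K, (a k).α • P.modalSplit (a k).y (a k).dy

/-- The recovered link flows by mode: the average of the `f^k` with weights `α_k / A_K`. -/
def fhat (h : LinkVec E → ℝ) (L₀ : ℝ) (a : ℕ → Attempt E O D Pu Ag Mo) (K : ℕ) :
    ModeFlow E Mo :=
  (1 / (P.state h L₀ a K).A) • ∑ k ∈ Finset.range K, (a k).α • (a k).fy

/-- The duality gap `P₃(d̂^K, f̂^K) - D₃'(t^K)`. -/
def gap (σ : E → ℝ → ℝ) (h : LinkVec E → ℝ) (L₀ : ℝ) (a : ℕ → Attempt E O D Pu Ag Mo)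
    (K : ℕ) : ℝ :=
  P.P3 σ (P.dhat h L₀ a K) (P.fhat h L₀ a K) - P.dual h (P.state h L₀ a K).t

/-- The vector `(f - f̄)₊` of capacity violations. -/
def excess (f : ModeFlow E Mo) : LinkVec E :=
  WithLp.toLp 2 (fun e => max (totalFlow f e - P.fbar e) 0)

end Model

end TrafficUSTM

end

noncomputable section

namespace TrafficUSTM

open scoped BigOperators

set_option linter.unusedSectionVars false

/-! ### Entropy inequalities -/

/-! The linear model at `y` equals minus (travel cost of the computed flow plus `H` of its modal
split), because the logit split attains equality in Gibbs' inequality and the flow uses shortest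
paths. Since `H` is convex, averaging these models bounds the estimating function by the primal
objective at the averaged point. Weak duality supplies the lower bounds on the gap.

All admissible flows are nonnegative with squared norm at most `N² * maxLen`, so two of them differ
by at most `M`. The smooth part therefore satisfies a nonsmooth upper bound with slope error `M`,
and the line search cannot let the weight `α` fall below `ε / (4 M²)`. A standard similar-triangles
argument then gives `A (phi3 + h)(t^k) ≤ min φ_k + accumulated error`.

The sharp constant comes from counting the error of a step twice: the acceptance test gives one
bound, the slope error `M` another. Their minimum lies below `ε (7/8 α - ε / (8 M²))`, so each step
saves `ε² / (8 M²)`. After `K ≥ 4 (M R / ε)²` steps the savings pay for the prox term `R² / 2`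
(`half_sq_le`).

It remains to choose a test point in the estimate. For Beckmann it is the vector of link costs at
the averaged flow, where Fenchel's inequality is an equality and the distance to `tbar` is at most
`Rtilde`. For stable dynamics it is `tbar + A • excess`, which produces a quadratic penalty on the
capacity violation. The main lemmas are `IsAttempt.accepted_upper`, `Invariant.step` and
`IsRun.outcome`. -/

theorem sub_le_mul_log_div {x q : ℝ} (hx : 0 ≤ x) (hq : 0 ≤ q) (h : q = 0 → x = 0) :
    x - q ≤ x * Real.log (x / q) := by
  rcases hx.eq_or_lt with rfl | hx'
  · simpa using hq
  · have hq' : 0 < q := lt_of_le_of_ne hq fun h0 => hx'.ne' (h h0.symm)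
    have h1 := Real.one_sub_inv_le_log_of_pos (div_pos hx' hq')
    calc x - q = x * (1 - (x / q)⁻¹) := by field_simp
      _ ≤ _ := mul_le_mul_of_nonneg_left h1 hx

/-- The two-term log-sum inequality. -/
theorem log_sum_ineq {x s y r a b : ℝ} (hx : 0 ≤ x) (hy : 0 ≤ y) (hxs : x ≤ s) (hyr : y ≤ r)
    (ha : 0 ≤ a) (hb : 0 ≤ b) :
    (a * x + b * y) * Real.log ((a * x + b * y) / (a * s + b * r)) ≤
      a * (x * Real.log (x / s)) + b * (y * Real.log (y / r)) := by
  set X := a * x + b * y with hX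
  set S := a * s + b * r with hS
  have hX0 : 0 ≤ X := by positivity
  rcases hX0.eq_or_lt with h0 | hXpos
  · have h1 : a * x = 0 ∧ b * y = 0 := by
      have := mul_nonneg ha hx
      have := mul_nonneg hb hy
      constructor <;> linarith
    rw [← h0, ← mul_assoc, ← mul_assoc, h1.1, h1.2]
    simp
  · have hSpos : 0 < S := by
      have := mul_le_mul_of_nonneg_left hxs ha
      have := mul_le_mul_of_nonneg_left hyr hb
      linarith
    -- Tangent bound for `z ↦ z log (z / q)` at the common ratio `X / S`; the corrections cancel in
    -- the weighted sum.
    have key : ∀ z q : ℝ, 0 ≤ z → z ≤ q →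
        z * Real.log (X / S) + (z - q * (X / S)) ≤ z * Real.log (z / q) := by
      intro z q hz hzq
      rcases hz.eq_or_lt with rfl | hz'
      · have : 0 ≤ q * (X / S) := by positivity
        simp only [zero_mul, zero_sub, zero_add]
        linarith
      · have hq : 0 < q := hz'.trans_le hzq
        have h1 := sub_le_mul_log_div hz (q := q * (X / S)) (by positivity)
          (fun h => absurd h (by positivity))
        rw [← div_div, Real.log_div (by positivity) (by positivity)] at h1
        linarith
    have h1 := mul_le_mul_of_nonneg_left (key x s hx hxs) ha
    have h2 := mul_le_mul_of_nonneg_left (key y r hy hyr) hb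
    have h3 : a * (x - s * (X / S)) + b * (y - r * (X / S)) = 0 := by
      have : a * (x - s * (X / S)) + b * (y - r * (X / S)) = X - S * (X / S) := by
        rw [hX, hS]; ring
      rw [this, mul_div_cancel₀ _ hSpos.ne', sub_self]
    have h4 : X * Real.log (X / S) = a * (x * Real.log (X / S)) + b * (y * Real.log (X / S)) := by
      rw [hX]; ring
    linarith

/-! ### Logit split, Gibbs' inequality and convexity of the entropy term. -/

namespace Model

variable {V E O D Pu Ag Mo : Type*} [Fintype V] [Fintype E] [Fintype O] [Fintype D]
  [Fintype Pu] [Fintype Ag] [Fintype Mo] (P : Model V E O D Pu Ag Mo)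

/-- Trips by purpose, agent type, origin and destination, summed over the modes. -/
def marginal (d : ModeTrips O D Pu Ag Mo) : Trips O D Pu Ag := fun r a i j => ∑ m, d r a m i j

/-- The partition function of the modal split. -/
def partition (t : LinkVec E) (a : Ag) (i : O) (j : D) : ℝ :=
  ∑ m ∈ P.nest a, Real.exp (-P.α a * P.T t m i j - P.β a m)

theorem partition_pos (t : LinkVec E) (a : Ag) (i : O) (j : D) : 0 < P.partition t a i j :=
  Finset.sum_pos (fun _ _ => Real.exp_pos _) (P.nest_nonempty a)

theorem Tcomp_eq (t : LinkVec E) (a : Ag) (i : O) (j : D) :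
    P.Tcomp t a i j = -(1 / P.α a) * Real.log (P.partition t a i j) := rfl

theorem mode_term_eq (t : LinkVec E) (a : Ag) (i : O) (j : D) (m : Mo) (x s : ℝ) :
    x * P.T t m i j + 1 / P.α a * (x * (Real.log (x / s) + P.β a m)) =
      1 / P.α a * (x * (Real.log (x / s) - (-P.α a * P.T t m i j - P.β a m))) := by
  have := (P.α_pos a).ne'
  field_simp
  ring

/-- Gibbs' variational inequality for the composite costs. -/
theorem mul_Tcomp_le (t : LinkVec E) (a : Ag) (i : O) (j : D) (x : Mo → ℝ)
    (hx : ∀ m, 0 ≤ x m) (hoff : ∀ m, m ∉ P.nest a → x m = 0) :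
    (∑ m, x m) * P.Tcomp t a i j ≤ ∑ m, x m * P.T t m i j +
      ∑ m, 1 / P.α a * (x m * (Real.log (x m / ∑ m', x m') + P.β a m)) := by
  set s := ∑ m, x m with hs
  have hα := P.α_pos a
  have hZ := P.partition_pos t a i j
  set Z := P.partition t a i j with hZdef
  have hs0 : 0 ≤ s := Finset.sum_nonneg fun m _ => hx m
  have hsn : ∑ m ∈ P.nest a, x m = s :=
    Finset.sum_subset (Finset.subset_univ _) fun m _ hm => hoff m hm
  -- Compare `x` with the logit split of the same total `s`; the left-hand sides sum to zero over
  -- the nest.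
  have key : ∀ m ∈ P.nest a, x m - s / Z * Real.exp (-P.α a * P.T t m i j - P.β a m) ≤
      x m * (Real.log (x m / s) - (-P.α a * P.T t m i j - P.β a m)) + x m * Real.log Z := by
    intro m _
    rcases (hx m).eq_or_lt with h0 | h0
    · rw [← h0]
      have : 0 ≤ s / Z * Real.exp (-P.α a * P.T t m i j - P.β a m) := by positivity
      linarith
    · have hspos : 0 < s := h0.trans_le (Finset.single_le_sum (fun m _ => hx m) (Finset.mem_univ m))
      have h1 := sub_le_mul_log_div (hx m)
        (q := s / Z * Real.exp (-P.α a * P.T t m i j - P.β a m)) (by positivity)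
        (fun h => absurd h (by positivity))
      rw [Real.log_div h0.ne' (by positivity), Real.log_mul (by positivity) (by positivity),
        Real.log_div hspos.ne' hZ.ne', Real.log_exp] at h1
      rw [Real.log_div h0.ne' hspos.ne']
      linarith
  have hsum := Finset.sum_le_sum key
  rw [Finset.sum_sub_distrib, ← Finset.mul_sum, Finset.sum_add_distrib, ← Finset.sum_mul, hsn] at hsum
  have hZ' : ∑ m ∈ P.nest a, Real.exp (-P.α a * P.T t m i j - P.β a m) = Z := rfl
  rw [hZ', div_mul_cancel₀ _ hZ.ne', sub_self] at hsum
  rw [← Finset.sum_add_distrib, Finset.sum_congr rfl fun m _ => P.mode_term_eq t a i j m (x m) s,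
    ← Finset.mul_sum, ← Finset.sum_subset (Finset.subset_univ (P.nest a))
      (fun m _ hm => by rw [hoff m hm]; simp), Tcomp_eq]
  have : 0 ≤ 1 / P.α a := by positivity
  have := mul_le_mul_of_nonneg_left hsum this
  linarith

theorem modalSplit_of_mem {a : Ag} {m : Mo} (hm : m ∈ P.nest a) (t : LinkVec E)
    (d : Trips O D Pu Ag) (r : Pu) (i : O) (j : D) :
    P.modalSplit t d r a m i j =
      d r a i j * (Real.exp (-P.α a * P.T t m i j - P.β a m) / P.partition t a i j) :=
  if_pos hm

theorem modalSplit_of_notMem {a : Ag} {m : Mo} (hm : m ∉ P.nest a) (t : LinkVec E)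
    (d : Trips O D Pu Ag) (r : Pu) (i : O) (j : D) : P.modalSplit t d r a m i j = 0 :=
  if_neg hm

theorem modalSplit_nonneg {d : Trips O D Pu Ag} (hd : ∀ r a i j, 0 ≤ d r a i j) (t : LinkVec E)
    (r : Pu) (a : Ag) (m : Mo) (i : O) (j : D) : 0 ≤ P.modalSplit t d r a m i j := by
  by_cases hm : m ∈ P.nest a
  · rw [P.modalSplit_of_mem hm]
    have := hd r a i j
    have := P.partition_pos t a i j
    positivity
  · rw [P.modalSplit_of_notMem hm]

theorem sum_modalSplit (t : LinkVec E) (d : Trips O D Pu Ag) (r : Pu) (a : Ag) (i : O) (j : D) :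
    ∑ m, P.modalSplit t d r a m i j = d r a i j := by
  rw [← Finset.sum_subset (Finset.subset_univ (P.nest a))
    (fun m _ hm => P.modalSplit_of_notMem hm t d r i j),
    Finset.sum_congr rfl fun m hm => P.modalSplit_of_mem hm t d r i j, ← Finset.mul_sum,
    ← Finset.sum_div]
  have : ∑ m ∈ P.nest a, Real.exp (-P.α a * P.T t m i j - P.β a m) = P.partition t a i j := rfl
  rw [this, div_self (P.partition_pos t a i j).ne', mul_one]

theorem marginal_modalSplit (t : LinkVec E) (d : Trips O D Pu Ag) :
    marginal (P.modalSplit t d) = d := by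
  funext r a i j
  exact P.sum_modalSplit t d r a i j

/-- The logit split attains equality in Gibbs' inequality. -/
theorem mul_Tcomp_eq (t : LinkVec E) (d : Trips O D Pu Ag) (r : Pu) (a : Ag) (i : O) (j : D) :
    d r a i j * P.Tcomp t a i j = ∑ m, P.modalSplit t d r a m i j * P.T t m i j +
      ∑ m, 1 / P.α a * (P.modalSplit t d r a m i j *
        (Real.log (P.modalSplit t d r a m i j / ∑ m', P.modalSplit t d r a m' i j) + P.β a m)) := by
  have hZ := P.partition_pos t a i j
  rw [← Finset.sum_add_distrib, Finset.sum_congr rfl fun m _ => P.mode_term_eq t a i j m _ _,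
    ← Finset.mul_sum, P.sum_modalSplit]
  have key : ∀ m, P.modalSplit t d r a m i j *
      (Real.log (P.modalSplit t d r a m i j / d r a i j) - (-P.α a * P.T t m i j - P.β a m)) =
      P.modalSplit t d r a m i j * (-Real.log (P.partition t a i j)) := by
    intro m
    by_cases hm : m ∈ P.nest a
    · rw [P.modalSplit_of_mem hm]
      by_cases hd : d r a i j = 0
      · simp [hd]
      · rw [mul_div_cancel_left₀ _ hd, Real.log_div (Real.exp_pos _).ne' hZ.ne', Real.log_exp]
        ring
    · rw [P.modalSplit_of_notMem hm]; simp
  rw [Finset.sum_congr rfl fun m _ => key m, ← Finset.sum_mul, P.sum_modalSplit, Tcomp_eq]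
  ring

/-- Total travel costs of the trips `d` at shortest path costs. -/
def tripCost (t : LinkVec E) (d : ModeTrips O D Pu Ag Mo) : ℝ :=
  ∑ r, ∑ a, ∑ i, ∑ j, ∑ m, d r a m i j * P.T t m i j

theorem Ent_marginal_le (t : LinkVec E) {d : ModeTrips O D Pu Ag Mo}
    (hd : ∀ r a m i j, 0 ≤ d r a m i j) (hoff : ∀ r a m i j, m ∉ P.nest a → d r a m i j = 0) :
    P.Ent (marginal d) t ≤ P.tripCost t d + P.H d := by
  have key : ∑ r, ∑ a, ∑ i, ∑ j, marginal d r a i j * P.Tcomp t a i j ≤ P.tripCost t d +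
      ∑ r, ∑ a, ∑ i, ∑ j, ∑ m, 1 / P.α a *
      (d r a m i j * (Real.log (d r a m i j / ∑ m', d r a m' i j) + P.β a m)) := by
    unfold tripCost
    simp only [← Finset.sum_add_distrib]
    refine Finset.sum_le_sum fun r _ => Finset.sum_le_sum fun a _ => Finset.sum_le_sum fun i _ =>
      Finset.sum_le_sum fun j _ => ?_
    have := P.mul_Tcomp_le t a i j (fun m => d r a m i j) (fun m => hd r a m i j)
      (fun m hm => hoff r a m i j hm)
    rw [← Finset.sum_add_distrib] at this
    exact this
  unfold Ent H
  unfold marginal at key ⊢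
  linarith

theorem Ent_eq_modalSplit (t : LinkVec E) (d : Trips O D Pu Ag) :
    P.Ent d t = P.tripCost t (P.modalSplit t d) + P.H (P.modalSplit t d) := by
  unfold Ent H tripCost
  simp only [P.mul_Tcomp_eq t d, Finset.sum_add_distrib, P.sum_modalSplit]
  ring

/-- The marginal term is convex as `x log x` of a linear map. The modal term is a relative entropy,
jointly convex in the trips and their marginal by `log_sum_ineq`; the `β` part is linear. -/
theorem H_convex : ConvexOn ℝ {d : ModeTrips O D Pu Ag Mo | ∀ r a m i j, 0 ≤ d r a m i j} P.H := by
  refine ⟨fun x hx y hy a b ha hb _ r g m i j => ?_, fun x hx y hy a b ha hb hab => ?_⟩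
  · have := hx r g m i j
    have := hy r g m i j
    simp only [Pi.add_apply, Pi.smul_apply, smul_eq_mul]
    positivity
  · have e1 : ∀ r g i j, ∑ m, (a • x + b • y) r g m i j =
        a * ∑ m, x r g m i j + b * ∑ m, y r g m i j := by
      intro r g i j
      simp [Finset.sum_add_distrib, Finset.mul_sum]
    unfold H
    simp only [smul_eq_mul, mul_add, e1]
    have h1 : ∑ r, ∑ g, ∑ i, ∑ j, 1 / P.γ r * ((a * ∑ m, x r g m i j + b * ∑ m, y r g m i j) *
        Real.log (a * ∑ m, x r g m i j + b * ∑ m, y r g m i j)) ≤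
        a * ∑ r, ∑ g, ∑ i, ∑ j, 1 / P.γ r *
          ((∑ m, x r g m i j) * Real.log (∑ m, x r g m i j)) +
        b * ∑ r, ∑ g, ∑ i, ∑ j, 1 / P.γ r *
          ((∑ m, y r g m i j) * Real.log (∑ m, y r g m i j)) := by
      simp only [Finset.mul_sum (s := (Finset.univ : Finset Pu)),
        Finset.mul_sum (s := (Finset.univ : Finset Ag)), Finset.mul_sum (s := (Finset.univ : Finset O)),
        Finset.mul_sum (s := (Finset.univ : Finset D)), ← Finset.sum_add_distrib]
      refine Finset.sum_le_sum fun r _ => Finset.sum_le_sum fun g _ => Finset.sum_le_sum fun i _ =>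
        Finset.sum_le_sum fun j _ => ?_
      have h := Real.convexOn_mul_log.2 (x := ∑ m, x r g m i j) (y := ∑ m, y r g m i j)
        (Finset.sum_nonneg fun m _ => hx r g m i j) (Finset.sum_nonneg fun m _ => hy r g m i j)
        ha hb hab
      simp only [smul_eq_mul] at h
      have hγ : 0 ≤ 1 / P.γ r := by have := P.γ_pos r; positivity
      have := mul_le_mul_of_nonneg_left h hγ
      linarith
    have h2 : ∑ r, ∑ g, ∑ i, ∑ j, ∑ m, (1 / P.α g * ((a • x + b • y) r g m i j *
        Real.log ((a • x + b • y) r g m i j /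
          (a * ∑ m, x r g m i j + b * ∑ m, y r g m i j))) +
          1 / P.α g * ((a • x + b • y) r g m i j * P.β g m)) ≤
        a * ∑ r, ∑ g, ∑ i, ∑ j, ∑ m, (1 / P.α g *
          (x r g m i j * Real.log (x r g m i j / ∑ m', x r g m' i j)) +
            1 / P.α g * (x r g m i j * P.β g m)) +
        b * ∑ r, ∑ g, ∑ i, ∑ j, ∑ m, (1 / P.α g *
          (y r g m i j * Real.log (y r g m i j / ∑ m', y r g m' i j)) +
            1 / P.α g * (y r g m i j * P.β g m)) := by
      simp only [Finset.mul_sum (s := (Finset.univ : Finset Pu)),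
        Finset.mul_sum (s := (Finset.univ : Finset Ag)), Finset.mul_sum (s := (Finset.univ : Finset O)),
        Finset.mul_sum (s := (Finset.univ : Finset D)), ← Finset.sum_add_distrib]
      refine Finset.sum_le_sum fun r _ => Finset.sum_le_sum fun g _ => Finset.sum_le_sum fun i _ =>
        Finset.sum_le_sum fun j _ => ?_
      have hle : ∀ z : ModeTrips O D Pu Ag Mo, (∀ r a m i j, 0 ≤ z r a m i j) →
          ∀ m, z r g m i j ≤ ∑ m', z r g m' i j := fun z hz m =>
        Finset.single_le_sum (f := fun m => z r g m i j) (fun m _ => hz r g m i j)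
          (Finset.mem_univ m)
      have hxS := hle x hx
      have hyS := hle y hy
      generalize ∑ m, x r g m i j = S at hxS ⊢
      generalize ∑ m, y r g m i j = S' at hyS ⊢
      rw [Finset.mul_sum, Finset.mul_sum, ← Finset.sum_add_distrib]
      refine Finset.sum_le_sum fun m _ => ?_
      have h := log_sum_ineq (hx r g m i j) (hy r g m i j) (hxS m) (hyS m) ha hb
      have hα : 0 ≤ 1 / P.α g := by have := P.α_pos g; positivity
      have := mul_le_mul_of_nonneg_left h hα
      simp only [Pi.add_apply, Pi.smul_apply, smul_eq_mul]
      linarith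
    linarith

end Model

/-! ### Linear functionals on link vectors and convex hulls of paths. -/

/-- The linear functional `v ↦ ∑ e, g e * v e`. -/
def pairing {E : Type*} [Fintype E] (g : E → ℝ) : LinkVec E →ₗ[ℝ] ℝ :=
  innerₛₗ ℝ (WithLp.toLp 2 g : LinkVec E)

theorem pairing_apply {E : Type*} [Fintype E] (g : E → ℝ) (v : LinkVec E) :
    pairing g v = ∑ e, g e * v e := by
  simp [pairing, PiLp.inner_apply, mul_comm]

theorem inner_eq_sum {E : Type*} [Fintype E] (x y : LinkVec E) :
    inner ℝ x y = ∑ e, x e * y e := by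
  simp [PiLp.inner_apply, mul_comm]

theorem pairing_incidence {E : Type*} [Fintype E] (g : E → ℝ) {p : List E} (hp : p.Nodup) :
    pairing g (incidence p) = (p.map g).sum := by
  classical
  rw [pairing_apply, ← List.sum_toFinset g hp]
  simp [incidence, Set.indicator_apply, Finset.sum_ite]
  congr 1
  ext e
  simp

theorem le_of_mem_convexHull {F : Type*} [AddCommGroup F] [Module ℝ F] (ℓ : F →ₗ[ℝ] ℝ) {s : Set F}
    {b : ℝ} (h : ∀ x ∈ s, b ≤ ℓ x) {x : F} (hx : x ∈ convexHull ℝ s) : b ≤ ℓ x :=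
  convexHull_min (t := {w | b ≤ ℓ w}) h (convex_halfSpace_ge ℓ.isLinear b) hx

theorem ge_of_mem_convexHull {F : Type*} [AddCommGroup F] [Module ℝ F] (ℓ : F →ₗ[ℝ] ℝ) {s : Set F}
    {b : ℝ} (h : ∀ x ∈ s, ℓ x ≤ b) {x : F} (hx : x ∈ convexHull ℝ s) : ℓ x ≤ b :=
  convexHull_min (t := {w | ℓ w ≤ b}) h (convex_halfSpace_le ℓ.isLinear b) hx

theorem IsSimplePath.nodup {V E : Type*} {src tgt : E → V} {i j : V} {p : List E}
    (h : IsSimplePath src tgt i j p) : p.Nodup :=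
  List.Nodup.of_map _ (List.nodup_cons.1 h.2).2

theorem IsSimplePath.length_le {V E : Type*} [Fintype V] {src tgt : E → V} {i j : V} {p : List E}
    (h : IsSimplePath src tgt i j p) : p.length ≤ Fintype.card V := by
  have := h.2.length_le_card
  simp at this
  omega

theorem totalFlow_apply {E Mo : Type*} [Fintype Mo] (f : ModeFlow E Mo) (e : E) :
    totalFlow f e = ∑ m, f m e := by
  simp [totalFlow]

theorem totalFlow_combo {E Mo : Type*} [Fintype Mo] (a b : ℝ) (f g : ModeFlow E Mo) :
    totalFlow (a • f + b • g) = a • totalFlow f + b • totalFlow g := by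
  simp [totalFlow, Finset.sum_add_distrib, Finset.smul_sum]

namespace Model

variable {V E O D Pu Ag Mo : Type*} [Fintype V] [Fintype E] [Fintype O] [Fintype D]
  [Fintype Pu] [Fintype Ag] [Fintype Mo] (P : Model V E O D Pu Ag Mo)

/-! ### Shortest paths -/

theorem paths_nonempty (m : Mo) (i : O) (j : D) : (P.paths m i j).Nonempty := P.path_exists m i j

theorem paths_finite (m : Mo) (i : O) (j : D) : (P.paths m i j).Finite :=
  (List.finite_length_le E (Fintype.card V)).subset fun _ hp => hp.1.length_le

theorem length_le_maxLen {m : Mo} {i : O} {j : D} {p : List E} (hp : p ∈ P.paths m i j) :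
    p.length ≤ P.maxLen := by
  refine le_csSup ⟨Fintype.card V, ?_⟩ ⟨_, _, p, hp.1, rfl⟩
  rintro n ⟨i, j, p, h, rfl⟩
  exact h.length_le

theorem T_le (t : LinkVec E) {m : Mo} {i : O} {j : D} {p : List E} (hp : p ∈ P.paths m i j) :
    P.T t m i j ≤ P.pathCost m t p :=
  csInf_le ((P.paths_finite m i j).image _).bddBelow ⟨p, hp, rfl⟩

theorem shortest_nonempty (t : LinkVec E) (m : Mo) (i : O) (j : D) :
    (P.shortest t m i j).Nonempty := by
  obtain ⟨p, hp, h⟩ := ((P.paths_nonempty m i j).image (P.pathCost m t)).csInf_mem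
    ((P.paths_finite m i j).image _)
  exact ⟨p, hp, h⟩

theorem pairing_path {m : Mo} {i : O} {j : D} {p : List E} (hp : p ∈ P.paths m i j)
    (t : LinkVec E) : pairing (fun e => t e + P.c m e) (incidence p) = P.pathCost m t p :=
  pairing_incidence _ hp.1.nodup

/-! ### Trips and flows that satisfy the network constraints -/

/-- Travel costs of the link flows `f` for link times `t`. -/
def travelCost (t : LinkVec E) (f : ModeFlow E Mo) : ℝ :=
  ∑ m, pairing (fun e => t e + P.c m e) (f m)

theorem travelCost_eq (t : LinkVec E) (f : ModeFlow E Mo) :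
    P.travelCost t f = inner ℝ (totalFlow f) t + ∑ e, ∑ m, P.c m e * f m e := by
  simp only [travelCost, pairing_apply, inner_eq_sum, totalFlow_apply, add_mul,
    Finset.sum_add_distrib, Finset.sum_mul]
  rw [Finset.sum_comm, Finset.sum_comm (f := fun m e => P.c m e * f m e)]
  simp only [mul_comm]

/-- The trips and link flows satisfy all linear constraints which follow from the trips being
feasible and sent along paths of the network. -/
structure IsConsistent (d : ModeTrips O D Pu Ag Mo) (f : ModeFlow E Mo) : Prop where
  nonneg : ∀ r a m i j, 0 ≤ d r a m i j
  off_nest : ∀ r a m i j, m ∉ P.nest a → d r a m i j = 0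
  feasible : marginal d ∈ P.feasible
  cost : ∀ t, P.tripCost t d ≤ P.travelCost t f
  flow_nonneg : ∀ e, 0 ≤ totalFlow f e
  flow_le : ∀ e, totalFlow f e ≤ P.N
  flow_sum : ∑ e, totalFlow f e ≤ P.N * P.maxLen

theorem marginal_combo (a b : ℝ) (x y : ModeTrips O D Pu Ag Mo) :
    marginal (a • x + b • y) = a • marginal x + b • marginal y := by
  funext r g i j
  simp [marginal, Finset.sum_add_distrib, Finset.mul_sum]

theorem feasible_convex : Convex ℝ P.feasible := by
  rintro x ⟨hx0, hx1, hx2⟩ y ⟨hy0, hy1, hy2⟩ a b ha hb hab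
  refine ⟨fun r g i j => ?_, fun r g i => ?_, fun r j => ?_⟩
  · have := hx0 r g i j
    have := hy0 r g i j
    simp only [Pi.add_apply, Pi.smul_apply, smul_eq_mul]
    positivity
  · simp only [Pi.add_apply, Pi.smul_apply, smul_eq_mul, Finset.sum_add_distrib, ← Finset.mul_sum,
      hx1, hy1]
    rw [← add_mul, hab, one_mul]
  · simp only [Pi.add_apply, Pi.smul_apply, smul_eq_mul, Finset.sum_add_distrib, ← Finset.mul_sum,
      hx2, hy2]
    rw [← add_mul, hab, one_mul]

theorem tripCost_combo (t : LinkVec E) (a b : ℝ) (x y : ModeTrips O D Pu Ag Mo) :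
    P.tripCost t (a • x + b • y) = a * P.tripCost t x + b * P.tripCost t y := by
  simp only [tripCost, Pi.add_apply, Pi.smul_apply, smul_eq_mul, add_mul, Finset.sum_add_distrib,
    Finset.mul_sum, mul_assoc]

theorem travelCost_combo (t : LinkVec E) (a b : ℝ) (f g : ModeFlow E Mo) :
    P.travelCost t (a • f + b • g) = a * P.travelCost t f + b * P.travelCost t g := by
  simp only [travelCost, Pi.add_apply, Pi.smul_apply, map_add, map_smul, smul_eq_mul,
    Finset.sum_add_distrib, Finset.mul_sum]

/-- Every condition is linear in the pair. This is why consistency, unlike being a shortest flow for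
a single `t`, survives averaging over the iterations. -/
theorem isConsistent_convex :
    Convex ℝ {q : ModeTrips O D Pu Ag Mo × ModeFlow E Mo | P.IsConsistent q.1 q.2} := by
  rintro ⟨x, f⟩ hx ⟨y, g⟩ hy a b ha hb hab
  change P.IsConsistent x f at hx
  change P.IsConsistent y g at hy
  change P.IsConsistent (a • x + b • y) (a • f + b • g)
  refine ⟨fun r g m i j => ?_, fun r g m i j hm => ?_, ?_, fun t => ?_, fun e => ?_, fun e => ?_, ?_⟩
  · have := hx.nonneg r g m i j
    have := hy.nonneg r g m i j
    simp only [Pi.add_apply, Pi.smul_apply, smul_eq_mul]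
    positivity
  · simp [hx.off_nest r g m i j hm, hy.off_nest r g m i j hm]
  · rw [marginal_combo]
    exact P.feasible_convex hx.feasible hy.feasible ha hb hab
  · rw [tripCost_combo, travelCost_combo]
    have := mul_le_mul_of_nonneg_left (hx.cost t) ha
    have := mul_le_mul_of_nonneg_left (hy.cost t) hb
    linarith
  · rw [totalFlow_combo]
    have := hx.flow_nonneg e
    have := hy.flow_nonneg e
    simp only [PiLp.add_apply, PiLp.smul_apply, smul_eq_mul]
    positivity
  · rw [totalFlow_combo]
    simp only [PiLp.add_apply, PiLp.smul_apply, smul_eq_mul]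
    have := mul_le_mul_of_nonneg_left (hx.flow_le e) ha
    have := mul_le_mul_of_nonneg_left (hy.flow_le e) hb
    calc _ ≤ a * P.N + b * P.N := by linarith
      _ = P.N := by rw [← add_mul, hab, one_mul]
  · rw [totalFlow_combo]
    simp only [PiLp.add_apply, PiLp.smul_apply, smul_eq_mul, Finset.sum_add_distrib,
      ← Finset.mul_sum]
    have := mul_le_mul_of_nonneg_left hx.flow_sum ha
    have := mul_le_mul_of_nonneg_left hy.flow_sum hb
    calc _ ≤ a * (P.N * P.maxLen) + b * (P.N * P.maxLen) := by linarith
      _ = P.N * P.maxLen := by rw [← add_mul, hab, one_mul]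

theorem sum_mode_comm (F : Mo → Pu → Ag → O → D → ℝ) :
    ∑ m, ∑ r, ∑ a, ∑ i, ∑ j, F m r a i j = ∑ r, ∑ a, ∑ i, ∑ j, ∑ m, F m r a i j := by
  rw [Finset.sum_comm]
  refine Finset.sum_congr rfl fun r _ => ?_
  rw [Finset.sum_comm]
  refine Finset.sum_congr rfl fun a _ => ?_
  rw [Finset.sum_comm]
  refine Finset.sum_congr rfl fun i _ => ?_
  rw [Finset.sum_comm]

theorem sum_feasible {d : Trips O D Pu Ag} (hd : d ∈ P.feasible) :
    ∑ r, ∑ a, ∑ i, ∑ j, d r a i j = P.N := by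
  simp only [hd.2.1, P.balance, N]

theorem N_nonneg : 0 ≤ P.N := Finset.sum_nonneg fun r _ => Finset.sum_nonneg fun j _ => P.w_nonneg r j

section ShortestFlow

variable {P} {y : LinkVec E} {d : ModeTrips O D Pu Ag Mo}
  {v : Pu → Ag → Mo → O → D → LinkVec E} {f : ModeFlow E Mo}

theorem functional_totalFlow (hf : ∀ m, f m = ∑ r, ∑ a, ∑ i, ∑ j, d r a m i j • v r a m i j)
    (ℓ : LinkVec E →ₗ[ℝ] ℝ) :
    ℓ (totalFlow f) = ∑ r, ∑ a, ∑ i, ∑ j, ∑ m, d r a m i j * ℓ (v r a m i j) := by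
  rw [← sum_mode_comm (fun m r a i j => d r a m i j * ℓ (v r a m i j))]
  simp only [totalFlow, hf, map_sum, map_smul, smul_eq_mul]

theorem travelCost_flow (hf : ∀ m, f m = ∑ r, ∑ a, ∑ i, ∑ j, d r a m i j • v r a m i j)
    (t : LinkVec E) : P.travelCost t f =
      ∑ r, ∑ a, ∑ i, ∑ j, ∑ m, d r a m i j * pairing (fun e => t e + P.c m e) (v r a m i j) := by
  rw [← sum_mode_comm (fun m r a i j => d r a m i j * pairing (fun e => t e + P.c m e) (v r a m i j))]
  simp only [travelCost, hf, map_sum, map_smul, smul_eq_mul]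

theorem functional_totalFlow_le
    (hf : ∀ m, f m = ∑ r, ∑ a, ∑ i, ∑ j, d r a m i j • v r a m i j)
    (hd : ∀ r a m i j, 0 ≤ d r a m i j) (hfeas : marginal d ∈ P.feasible)
    {ℓ : LinkVec E →ₗ[ℝ] ℝ} {b : ℝ} (hb : ∀ r a m i j, ℓ (v r a m i j) ≤ b) :
    ℓ (totalFlow f) ≤ P.N * b := by
  rw [functional_totalFlow hf, ← P.sum_feasible hfeas]
  simp only [Finset.sum_mul, marginal]
  gcongr with r _ a _ i _ j _ m _
  · exact hd r a m i j
  · exact hb r a m i j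

theorem IsShortestFlow.travelCost_eq (h : P.IsShortestFlow y d f) :
    P.travelCost y f = P.tripCost y d := by
  obtain ⟨v, hv, hf⟩ := h
  rw [travelCost_flow hf]
  unfold tripCost
  refine Finset.sum_congr rfl fun r _ => Finset.sum_congr rfl fun a _ => Finset.sum_congr rfl
    fun i _ => Finset.sum_congr rfl fun j _ => Finset.sum_congr rfl fun m _ => ?_
  congr 1
  refine le_antisymm (ge_of_mem_convexHull _ ?_ (hv r a m i j))
    (le_of_mem_convexHull _ ?_ (hv r a m i j))
  all_goals
    rintro _ ⟨p, hp, rfl⟩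
    rw [P.pairing_path hp.1, hp.2]

theorem IsShortestFlow.isConsistent (h : P.IsShortestFlow y d f)
    (hd : ∀ r a m i j, 0 ≤ d r a m i j) (hoff : ∀ r a m i j, m ∉ P.nest a → d r a m i j = 0)
    (hfeas : marginal d ∈ P.feasible) : P.IsConsistent d f := by
  obtain ⟨v, hv, hf⟩ := h
  have hcoord : ∀ e : E, ∃ ℓ : LinkVec E →ₗ[ℝ] ℝ, ∀ x, ℓ x = x e := fun e =>
    ⟨⟨⟨fun x => x e, fun _ _ => rfl⟩, fun _ _ => rfl⟩, fun _ => rfl⟩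
  refine ⟨hd, hoff, hfeas, fun t => ?_, fun e => ?_, fun e => ?_, ?_⟩
  · rw [travelCost_flow hf]
    unfold tripCost
    gcongr with r _ a _ i _ j _ m _
    · exact hd r a m i j
    · refine le_of_mem_convexHull _ ?_ (hv r a m i j)
      rintro _ ⟨p, hp, rfl⟩
      rw [P.pairing_path hp.1]
      exact P.T_le t hp.1
  · obtain ⟨ℓ, hℓ⟩ := hcoord e
    rw [← hℓ, functional_totalFlow hf]
    refine Finset.sum_nonneg fun r _ => Finset.sum_nonneg fun a _ => Finset.sum_nonneg fun i _ =>
      Finset.sum_nonneg fun j _ => Finset.sum_nonneg fun m _ => mul_nonneg (hd r a m i j) ?_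
    refine le_of_mem_convexHull _ ?_ (hv r a m i j)
    rintro _ ⟨p, hp, rfl⟩
    rw [hℓ]
    exact Set.indicator_nonneg (fun _ _ => zero_le_one) e
  · obtain ⟨ℓ, hℓ⟩ := hcoord e
    rw [← hℓ]
    have := functional_totalFlow_le hf hd hfeas (ℓ := ℓ) (b := 1) fun r a m i j => by
      refine ge_of_mem_convexHull _ ?_ (hv r a m i j)
      rintro _ ⟨p, hp, rfl⟩
      rw [hℓ]
      exact Set.indicator_apply_le' (f := fun _ : E => (1 : ℝ)) (fun _ => le_rfl)
        fun _ => zero_le_one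
    simpa using this
  · have hsum : ∀ x : LinkVec E, ∑ e, x e = pairing (fun _ => 1) x := fun x => by
      simp [pairing_apply]
    rw [hsum]
    refine functional_totalFlow_le hf hd hfeas fun r a m i j => ?_
    refine ge_of_mem_convexHull _ ?_ (hv r a m i j)
    rintro _ ⟨p, hp, rfl⟩
    rw [pairing_incidence _ hp.1.1.nodup]
    simpa using P.length_le_maxLen hp.1

end ShortestFlow

theorem exists_isShortestFlow (y : LinkVec E) (d : ModeTrips O D Pu Ag Mo) :
    ∃ f, P.IsShortestFlow y d f := by
  choose p hp using P.shortest_nonempty y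
  exact ⟨_, fun _ _ m i j => incidence (p m i j),
    fun _ _ m i j => subset_convexHull ℝ _ ⟨_, hp m i j, rfl⟩, fun _ => rfl⟩

theorem isConsistent_modalSplit {y : LinkVec E} {d : Trips O D Pu Ag} (hd : d ∈ P.feasible)
    {f : ModeFlow E Mo} (h : P.IsShortestFlow y (P.modalSplit y d) f) :
    P.IsConsistent (P.modalSplit y d) f :=
  h.isConsistent (fun r a m i j => P.modalSplit_nonneg hd.1 y r a m i j)
    (fun r _ _ i j hm => P.modalSplit_of_notMem hm y d r i j)
    (by rwa [marginal_modalSplit])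

variable {P} in
theorem IsConsistent.Ent_le {d : ModeTrips O D Pu Ag Mo} {f : ModeFlow E Mo}
    (h : P.IsConsistent d f) (t : LinkVec E) : P.Ent (marginal d) t ≤ P.travelCost t f + P.H d :=
  (P.Ent_marginal_le t h.nonneg h.off_nest).trans (by linarith [h.cost t])

theorem Ent_eq_travelCost {y : LinkVec E} {d : Trips O D Pu Ag} {f : ModeFlow E Mo}
    (h : P.IsShortestFlow y (P.modalSplit y d) f) :
    P.Ent d y = P.travelCost y f + P.H (P.modalSplit y d) := by
  rw [P.Ent_eq_modalSplit, h.travelCost_eq]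

/-- Minus the total flow is a subgradient of `t ↦ -Ent(d, t)`. -/
theorem Ent_le_Ent_add_inner {y : LinkVec E} {d : Trips O D Pu Ag} (hd : d ∈ P.feasible)
    {f : ModeFlow E Mo} (h : P.IsShortestFlow y (P.modalSplit y d) f) (t : LinkVec E) :
    P.Ent d t ≤ P.Ent d y + inner ℝ (totalFlow f) (t - y) := by
  have h1 := (P.isConsistent_modalSplit hd h).Ent_le t
  rw [marginal_modalSplit] at h1
  rw [P.Ent_eq_travelCost h]
  rw [P.travelCost_eq] at h1 ⊢
  rw [inner_sub_right]
  linarith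

/-! ### Bounds on flows -/

section Norm
variable {P} {d d' : ModeTrips O D Pu Ag Mo} {f f' : ModeFlow E Mo}

theorem IsConsistent.norm_sq_le (h : P.IsConsistent d f) :
    ‖totalFlow f‖ ^ 2 ≤ P.N ^ 2 * P.maxLen := by
  rw [EuclideanSpace.norm_sq_eq]
  calc ∑ e, ‖totalFlow f e‖ ^ 2 ≤ ∑ e, P.N * totalFlow f e := by
        gcongr with e
        rw [Real.norm_eq_abs, sq_abs, sq]
        exact mul_le_mul_of_nonneg_right (h.flow_le e) (h.flow_nonneg e)
    _ = P.N * ∑ e, totalFlow f e := by rw [Finset.mul_sum]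
    _ ≤ P.N * (P.N * P.maxLen) := mul_le_mul_of_nonneg_left h.flow_sum P.N_nonneg
    _ = _ := by ring

theorem M_sq : P.M ^ 2 = 2 * (P.N ^ 2 * P.maxLen) := by
  rw [M, mul_pow, Real.sq_sqrt (by positivity)]
  ring

theorem M_nonneg : 0 ≤ P.M := mul_nonneg (Real.sqrt_nonneg _) P.N_nonneg

/-- Nonnegative flows have nonnegative inner product, so the squared norms just add; this gives the
factor 2 under the root in `M`. -/
theorem IsConsistent.norm_sub_le (h : P.IsConsistent d f) (h' : P.IsConsistent d' f') :
    ‖totalFlow f - totalFlow f'‖ ≤ P.M := by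
  refine abs_le_of_sq_le_sq' ?_ M_nonneg |>.2
  rw [M_sq, norm_sub_sq_real, inner_eq_sum]
  have h1 := h.norm_sq_le
  have h2 := h'.norm_sq_le
  have h3 : 0 ≤ ∑ e, totalFlow f e * totalFlow f' e :=
    Finset.sum_nonneg fun e _ => mul_nonneg (h.flow_nonneg e) (h'.flow_nonneg e)
  linarith

theorem IsConsistent.excess_sq_le (h : P.IsConsistent d f) : 2 * ‖P.excess f‖ ^ 2 ≤ P.M ^ 2 := by
  rw [M_sq]
  have : ‖P.excess f‖ ^ 2 ≤ ‖totalFlow f‖ ^ 2 := by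
    rw [EuclideanSpace.norm_sq_eq, EuclideanSpace.norm_sq_eq]
    gcongr with e
    have h1 := h.flow_nonneg e
    have h2 := P.fbar_pos e
    simp only [excess, Real.norm_eq_abs]
    rw [abs_of_nonneg h1, abs_of_nonneg (le_max_right _ _)]
    exact max_le (by linarith) h1
  linarith [h.norm_sq_le]

end Norm

/-! ### The dual function -/

/-- Needed because `sInf` of a set unbounded below is the default value 0. Trips are bounded by
productions, and `x log x ≥ x - 1 ≥ -1`. -/
theorem Ent_bddBelow (t : LinkVec E) : BddBelow ((fun d => P.Ent d t) '' P.feasible) := by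
  refine ⟨(∑ r, ∑ a, ∑ i, ∑ j : D, -(P.l r a i * |P.Tcomp t a i j|)) +
    ∑ r, ∑ _a : Ag, ∑ _i : O, ∑ _j : D, 1 / P.γ r * (-1), ?_⟩
  rintro _ ⟨d, hd, rfl⟩
  have hle : ∀ r a i j, d r a i j ≤ P.l r a i := fun r a i j => by
    rw [← hd.2.1 r a i]
    exact Finset.single_le_sum (f := fun j => d r a i j) (fun j _ => hd.1 r a i j)
      (Finset.mem_univ j)
  simp only [Ent]
  gcongr with r _ a _ i _ j _ r _ a _ i _ j _
  · have h1 := mul_le_mul_of_nonneg_right (hle r a i j) (abs_nonneg (P.Tcomp t a i j))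
    have h2 := mul_le_mul_of_nonneg_left (neg_abs_le (P.Tcomp t a i j)) (hd.1 r a i j)
    linarith
  · exact (one_div_pos.2 (P.γ_pos r)).le
  · have h1 := sub_le_mul_log_div (hd.1 r a i j) zero_le_one (by simp)
    rw [div_one] at h1
    linarith [hd.1 r a i j]

theorem neg_Ent_le_phi3 {d : Trips O D Pu Ag} (hd : d ∈ P.feasible) (t : LinkVec E) :
    -P.Ent d t ≤ P.phi3 t :=
  neg_le_neg (csInf_le (P.Ent_bddBelow t) ⟨d, hd, rfl⟩)

theorem phi3_le {t : LinkVec E} {B : ℝ} (hne : P.feasible.Nonempty)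
    (h : ∀ d ∈ P.feasible, -P.Ent d t ≤ B) : P.phi3 t ≤ B := by
  refine neg_le.1 (le_csInf (hne.image _) ?_)
  rintro _ ⟨d, hd, rfl⟩
  exact neg_le.1 (h d hd)

/-- Weak duality. -/
theorem IsConsistent.neg_phi3_le {P : Model V E O D Pu Ag Mo} {d : ModeTrips O D Pu Ag Mo}
    {f : ModeFlow E Mo} (h : P.IsConsistent d f) (t : LinkVec E) :
    -P.phi3 t ≤ P.travelCost t f + P.H d :=
  (neg_le.1 (P.neg_Ent_le_phi3 h.feasible t)).trans (h.Ent_le t)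

end Model

/-! ### Step sizes of the line search -/

/-- Case where the first trial constant `L / 2` is accepted, with `q = M²`. The bound on `L`
inherited from the previous step gives `ε² ≤ 8 q² α²`, and `√8 < 3`; at the start `L α = 2` gives
more than is needed. -/
theorem step_size_lower_of_halved {L A α ε q : ℝ} (hL : 0 < L) (hα : 0 < α) (hq : 0 < q)
    (hε : 0 < ε) (hA : (A = 0 ∧ L * ε ≤ q) ∨ L * ε ^ 2 ≤ 16 * q ^ 2 * A)
    (h : L / 2 * α ^ 2 = A + α) : ε ≤ 3 * q * α := by
  rcases hA with ⟨hA, hLε⟩ | hA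
  · subst hA
    have h1 : L * α = 2 := by
      have : α * (L * α - 2) = 0 := by linarith
      rcases mul_eq_zero.1 this with h0 | h0
      · exact absurd h0 hα.ne'
      · linarith
    have h2 := mul_le_mul_of_nonneg_right hLε hα.le
    have h3 : L * ε * α = 2 * ε := by rw [mul_right_comm, h1]
    have := mul_pos hq hα
    linarith
  · have h1 : L * ε ^ 2 ≤ L * (8 * q ^ 2 * α ^ 2) := by
      have : 16 * q ^ 2 * A ≤ 16 * q ^ 2 * (L / 2 * α ^ 2) :=
        mul_le_mul_of_nonneg_left (by linarith) (by positivity)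
      linarith
    have h2 := le_of_mul_le_mul_left h1 hL
    refine (abs_le_of_sq_le_sq' ?_ (by positivity)).2
    have : 0 ≤ q ^ 2 * α ^ 2 := by positivity
    linarith

/-- Here `α'` belongs to the rejected constant `L` and `α` to the accepted `2 L`. Doubling the
constant at most halves the weight, so 2 becomes 4; once `A ≥ ε / q` the loss is smaller and 3
suffices. -/
theorem step_size_lower_of_rejected {L A α α' ε q : ℝ} (hA : 0 ≤ A) (hα : 0 < α)
    (hα' : 0 < α') (hq : 0 < q) (hε : 0 < ε) (h' : L * α' ^ 2 = A + α')
    (h : L * 2 * α ^ 2 = A + α) (hrej : ε < 2 * q * α') :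
    ε ≤ 4 * q * α ∧ (ε ≤ q * A → ε ≤ 3 * q * α) := by
  have hhalf : α' ≤ 2 * α := by
    by_contra hlt
    push Not at hlt
    have e1 : α * (2 * (L * α) - 1) = A := by linarith
    have e2 : α' * (L * α' - 1) = A := by linarith
    have p1 : 0 ≤ 2 * (L * α) - 1 := nonneg_of_mul_nonneg_right (e1 ▸ hA) hα
    have hLpos : 0 < L := by
      by_contra hL
      have : L * α ≤ 0 := mul_nonpos_of_nonpos_of_nonneg (not_lt.1 hL) hα.le
      linarith
    have p2 : 2 * (L * α) - 1 < L * α' - 1 := by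
      have := mul_lt_mul_of_pos_left hlt hLpos
      linarith
    have p3 : α < α' := by linarith
    have p4 : α * (2 * (L * α) - 1) ≤ α' * (2 * (L * α) - 1) := mul_le_mul_of_nonneg_right p3.le p1
    have p5 : α' * (2 * (L * α) - 1) < α' * (L * α' - 1) := mul_lt_mul_of_pos_left p2 hα'
    linarith
  refine ⟨?_, fun hqA => ?_⟩
  · have := mul_le_mul_of_nonneg_left hhalf hq.le
    linarith
  · by_contra hlt
    push Not at hlt
    set c := ε / q with hc
    have hε' : ε = q * c := by rw [hc]; field_simp
    have hcpos : 0 < c := div_pos hε hq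
    have c1 : c < 2 * α' := by
      rw [hε'] at hrej; exact lt_of_mul_lt_mul_left (by linarith) hq.le
    have c2 : c ≤ A := by
      rw [hε'] at hqA; exact le_of_mul_le_mul_left hqA hq
    have c3 : 3 * α < c := by
      rw [hε'] at hlt; exact lt_of_mul_lt_mul_left (by linarith) hq.le
    -- Eliminating `L`. The extremal case is `α' = c / 2`, `A = c`, where the identity reduces to
    -- `(c + 4α)(c - 3α) = 0`: hence the constant 3. `f1` and `f2` reduce the general case to it.
    have e : α' ^ 2 * (A + α) = 2 * α ^ 2 * (A + α') := by rw [← h, ← h']; ring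
    have f1 : 0 ≤ (α' - c / 2) * ((α' + c / 2) * (A + α) - 2 * α ^ 2) := by
      refine mul_nonneg (by linarith) ?_
      have : (2 * α) * α ≤ (α' + c / 2) * (A + α) := by
        apply mul_le_mul <;> linarith
      linarith
    have f2 : 0 ≤ (A - c) * (c ^ 2 / 4 - 2 * α ^ 2) := by
      refine mul_nonneg (by linarith) ?_
      have : (3 * α) * (3 * α) ≤ c * c := by apply mul_le_mul <;> linarith
      linarith [sq_nonneg c]
    have f3 : 0 < c / 4 * ((c + 4 * α) * (c - 3 * α)) := by
      have : 0 < c - 3 * α := by linarith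
      positivity
    linarith

/-- Quadratic growth of a strongly convex function at a minimizer. -/
theorem add_half_norm_sq_le_of_isMinOn {F : Type*} [NormedAddCommGroup F] [InnerProductSpace ℝ F]
    {S : Set F} {φ : F → ℝ} (hφ : ConvexOn ℝ S fun t => φ t - 1 / 2 * ‖t‖ ^ 2) {u t : F}
    (hu : u ∈ S) (ht : t ∈ S) (hmin : IsMinOn φ S u) : φ u + 1 / 2 * ‖t - u‖ ^ 2 ≤ φ t := by
  have hsc : StrongConvexOn S 1 φ := strongConvexOn_iff_convex.2 hφ
  by_contra hlt
  push Not at hlt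
  set D := ‖t - u‖ ^ 2 with hD
  have hD0 : 0 ≤ D := by positivity
  set g := φ u + 1 / 2 * D - φ t with hg
  have hgpos : 0 < g := by linarith
  -- A step small enough that `s * D ≤ g`; it replaces the limit `s → 0`.
  set s := g / (g + D + 1) with hs
  have hspos : 0 < s := by positivity
  have hs1 : s < 1 := by rw [hs, div_lt_one (by positivity)]; linarith
  have h1 := hsc.2 ht hu hspos.le (by linarith : 0 ≤ 1 - s) (by ring)
  have h2 : φ u ≤ φ (s • t + (1 - s) • u) :=
    hmin (hφ.1 ht hu hspos.le (by linarith) (by ring))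
  simp only [smul_eq_mul, ← hD] at h1
  have h3 : 0 ≤ s * (φ t - φ u - (1 - s) * (1 / 2 * D)) := by linarith
  have h4 := nonneg_of_mul_nonneg_right h3 hspos
  have h5 : s * D ≤ g := by
    rw [hs, div_mul_eq_mul_div, div_le_iff₀ (by positivity)]
    have := mul_pos hgpos hgpos
    linarith
  linarith

/-! ### One iteration: linear model, step size and error. -/

namespace Model

variable {V E O D Pu Ag Mo : Type*} [Fintype V] [Fintype E] [Fintype O] [Fintype D]
  [Fintype Pu] [Fintype Ag] [Fintype Mo] {P : Model V E O D Pu Ag Mo}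

/-- Take the subgradient of `-Ent d` at `x`, replace its flow by `f` at cost `M ‖x - y‖`, then
replace `d` by the `δ`-optimal `dy` at `y`. -/
theorem neg_Ent_le_linear_add {δ : ℝ} {y : LinkVec E} {dy d : Trips O D Pu Ag}
    (hdy : P.IsDeltaSol δ y dy) {f : ModeFlow E Mo} (hf : P.IsShortestFlow y (P.modalSplit y dy) f)
    (hd : d ∈ P.feasible) (x : LinkVec E) :
    -P.Ent d x ≤ -P.Ent dy y + inner ℝ (-totalFlow f) (x - y) + P.M * ‖x - y‖ + δ := by
  obtain ⟨g, hg⟩ := P.exists_isShortestFlow x (P.modalSplit x d)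
  have h1 := P.Ent_le_Ent_add_inner hd hg y
  have h2 := hdy.2 d hd
  have h3 : inner ℝ (totalFlow g) (y - x) =
      inner ℝ (-totalFlow f) (x - y) + inner ℝ (totalFlow f - totalFlow g) (x - y) := by
    rw [← inner_add_left, ← neg_sub x y, inner_neg_right, ← inner_neg_left]
    congr 1
    abel
  have h4 := real_inner_le_norm (totalFlow f - totalFlow g) (x - y)
  have h5 := mul_le_mul_of_nonneg_right ((P.isConsistent_modalSplit hdy.1 hf).norm_sub_le
    (P.isConsistent_modalSplit hd hg)) (norm_nonneg (x - y))
  linarith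

theorem dom_convex : Convex ℝ P.dom := by
  intro x hx y hy a b ha hb hab e
  have h1 := mul_le_mul_of_nonneg_left (hx e) ha
  have h2 := mul_le_mul_of_nonneg_left (hy e) hb
  have h3 : P.tbar e = a * P.tbar e + b * P.tbar e := by rw [← add_mul, hab, one_mul]
  simp only [PiLp.add_apply, PiLp.smul_apply, smul_eq_mul]
  linarith

theorem linModel_combo (a : Attempt E O D Pu Ag Mo) {r s : ℝ} (hrs : r + s = 1)
    (x y : LinkVec E) :
    P.linModel a (r • x + s • y) = r * P.linModel a x + s * P.linModel a y := by
  have h : r • x + s • y - a.y = r • (x - a.y) + s • (y - a.y) := by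
    rw [smul_sub, smul_sub, sub_add_sub_comm, ← add_smul, hrs, one_smul]
  simp only [linModel, h, inner_add_right, real_inner_smul_right]
  linear_combination P.Ent a.dy a.y * (hrs)

theorem linModel_convex (a : Attempt E O D Pu Ag Mo) :
    ConvexOn ℝ Set.univ (P.linModel a) :=
  ⟨convex_univ, fun x _ y _ _ _ _ _ hrs => (P.linModel_combo a hrs x y).le⟩

section Attempt

variable {h : LinkVec E → ℝ} {ε L : ℝ} {s : State E} {a : Attempt E O D Pu Ag Mo}

/-- The bridge to the primal: it turns a weighted sum of linear models into averages of travel cost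
and `H`. -/
theorem IsAttempt.linModel_eq (ha : P.IsAttempt h ε s L a) (t : LinkVec E) :
    P.linModel a t = -(P.travelCost t a.fy + P.H (P.modalSplit a.y a.dy)) := by
  rw [linModel, P.Ent_eq_travelCost ha.fy_flow, travelCost_eq, travelCost_eq, inner_sub_right,
    inner_neg_left, inner_neg_left]
  ring

theorem IsAttempt.linModel_le (ha : P.IsAttempt h ε s L a) (t : LinkVec E) :
    P.linModel a t ≤ P.phi3 t := by
  have := (P.isConsistent_modalSplit ha.dy_sol.1 ha.fy_flow).neg_phi3_le t
  rw [ha.linModel_eq]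
  linarith

theorem IsAttempt.α_pos (ha : P.IsAttempt h ε s L a) (hL : 0 < L) : 0 < a.α := by
  rw [ha.α_eq]
  positivity

/-- The formula for `α` is the positive root of this quadratic, whose right-hand side is the new
`A`. -/
theorem IsAttempt.mul_sq_eq (ha : P.IsAttempt h ε s L a) (hL : 0 < L) (hA : 0 ≤ s.A) :
    L * a.α ^ 2 = s.A + a.α := by
  have h1 : (a.α - 1 / (2 * L)) ^ 2 = 1 / (4 * L ^ 2) + s.A / L := by
    rw [ha.α_eq, add_sub_cancel_left, Real.sq_sqrt (by positivity)]
  have h2 : L * (a.α - 1 / (2 * L)) ^ 2 = L * (1 / (4 * L ^ 2) + s.A / L) := by rw [h1]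
  have h3 : L * (a.α - 1 / (2 * L)) ^ 2 = L * a.α ^ 2 - a.α + 1 / (4 * L) := by
    field_simp; ring
  have h4 : L * (1 / (4 * L ^ 2) + s.A / L) = 1 / (4 * L) + s.A := by
    field_simp
  linarith

/-- The smoothness inequality at the new point for arbitrary feasible trips. -/
theorem IsAttempt.upper (ha : P.IsAttempt h ε s L a) (hL : 0 < L) {d : Trips O D Pu Ag}
    (hd : d ∈ P.feasible) :
    -P.Ent d a.t ≤ P.linModel a a.t + L / 2 * ‖a.t - a.y‖ ^ 2 + P.M ^ 2 / (2 * L) +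
      a.α * ε / (4 * a.A) := by
  have h1 := neg_Ent_le_linear_add ha.dy_sol ha.fy_flow hd a.t
  have h2 : P.M * ‖a.t - a.y‖ ≤ L / 2 * ‖a.t - a.y‖ ^ 2 + P.M ^ 2 / (2 * L) := by
    have : L / 2 * ‖a.t - a.y‖ ^ 2 + P.M ^ 2 / (2 * L) - P.M * ‖a.t - a.y‖ =
        (L * ‖a.t - a.y‖ - P.M) ^ 2 / (2 * L) := by field_simp; ring
    have : 0 ≤ (L * ‖a.t - a.y‖ - P.M) ^ 2 / (2 * L) := by positivity
    linarith
  unfold linModel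
  linarith

/-- The test allows twice the oracle error, and `upper` uses it only once. Rejection thus forces `M²
/ (2L)` above the remaining oracle error, and `L α² = A` clears `L`. -/
theorem IsAttempt.lt_of_not_accepted (ha : P.IsAttempt h ε s L a) (hL : 0 < L) (hA : 0 ≤ s.A)
    (hrej : ¬ P.Accepted ε a) : ε < 2 * P.M ^ 2 * a.α := by
  have hα := ha.α_pos hL
  have hLα := ha.mul_sq_eq hL hA
  rw [← ha.A_eq] at hLα
  have hA' : 0 < a.A := by rw [← hLα]; positivity
  have h1 := ha.upper hL ha.dt_sol.1
  unfold Accepted at hrej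
  rw [ha.L_eq] at hrej
  push Not at hrej
  have h2 : a.α / (2 * a.A) * ε = 2 * (a.α * ε / (4 * a.A)) := by field_simp; ring
  have h3 : a.α * ε / (4 * a.A) < P.M ^ 2 / (2 * L) := by linarith
  rw [div_lt_div_iff₀ (by positivity) (by positivity), ← hLα] at h3
  have h4 : (2 * L * a.α) * ε < (2 * L * a.α) * (2 * P.M ^ 2 * a.α) := by linarith
  exact lt_of_mul_lt_mul_left h4 (by positivity)

theorem LineSearch.spec (hls : P.LineSearch h ε s a) (hε : 0 < ε) (hM : 0 < P.M) (hL : 0 < s.L)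
    (hA : 0 ≤ s.A)
    (hLA : (s.A = 0 ∧ s.L * ε ≤ P.M ^ 2) ∨ s.L * ε ^ 2 ≤ 16 * (P.M ^ 2) ^ 2 * s.A) :
    0 < a.L ∧ P.IsAttempt h ε s a.L a ∧ P.Accepted ε a ∧ ε ≤ 4 * P.M ^ 2 * a.α ∧
      (ε ≤ P.M ^ 2 * s.A → ε ≤ 3 * P.M ^ 2 * a.α) := by
  obtain ⟨n, b, hb, hrej, hacc, rfl⟩ := hls
  have hpos : ∀ q : ℕ, 0 < s.L / 2 * 2 ^ q := fun q => by positivity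
  have hatt := hb n le_rfl
  have hLn := hatt.L_eq
  have hα := hatt.α_pos (hpos n)
  have hq : 0 < P.M ^ 2 := by positivity
  refine ⟨hLn ▸ hpos n, hLn.symm ▸ hatt, hacc, ?_⟩
  rcases n with _ | n
  · have h1 := hatt.mul_sq_eq (hpos 0) hA
    rw [pow_zero, mul_one] at h1
    have h2 := step_size_lower_of_halved hL hα hq hε hLA h1
    have : 0 < P.M ^ 2 * (b 0).α := by positivity
    exact ⟨by linarith, fun _ => h2⟩
  · have hatt' := hb n (Nat.le_succ n)
    have h1 := hatt.mul_sq_eq (hpos (n + 1)) hA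
    rw [pow_succ, ← mul_assoc] at h1
    exact step_size_lower_of_rejected hA hα (hatt'.α_pos (hpos n)) hq hε
      (hatt'.mul_sq_eq (hpos n) hA) h1
      (hatt'.lt_of_not_accepted (hpos n) hA (hrej n (Nat.lt_succ_self n)))

/-- The error made at an accepted point: the minimum of the error admitted by the acceptance test
and of the one coming from the smoothness inequality, bounded by a common linear function. -/
theorem IsAttempt.accepted_upper (ha : P.IsAttempt h ε s L a) (hL : 0 < L) (hA : 0 ≤ s.A)
    (hε : 0 < ε) (hM : 0 < P.M) (hacc : P.Accepted ε a) (hα4 : ε ≤ 4 * P.M ^ 2 * a.α) :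
    a.A * P.phi3 a.t ≤ a.A * (P.linModel a a.t + L / 2 * ‖a.t - a.y‖ ^ 2) +
      ε * (7 / 8 * a.α - ε / (8 * P.M ^ 2)) := by
  have hα := ha.α_pos hL
  have hLα := ha.mul_sq_eq hL hA
  rw [← ha.A_eq] at hLα
  have hA' : 0 < a.A := by rw [← hLα]; positivity
  have hq : 0 < P.M ^ 2 := by positivity
  have hne : P.feasible.Nonempty := ⟨_, ha.dt_sol.1⟩
  have e1 : a.A * (a.α * ε / (4 * a.A)) = a.α * ε / 4 := by field_simp
  have h1 : P.phi3 a.t ≤ P.linModel a a.t + L / 2 * ‖a.t - a.y‖ ^ 2 + P.M ^ 2 / (2 * L) +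
      a.α * ε / (4 * a.A) := P.phi3_le hne fun d hd => ha.upper hL hd
  -- The test controls only the inexact value at `t`, so passing to `phi3` costs one more oracle
  -- error: `3/4 α ε` in total after multiplying by `A`.
  have h2 : P.phi3 a.t ≤ P.linModel a a.t + L / 2 * ‖a.t - a.y‖ ^ 2 + a.α / (2 * a.A) * ε +
      a.α * ε / (4 * a.A) := P.phi3_le hne fun d hd => by
    have := ha.dt_sol.2 d hd
    unfold Accepted at hacc
    rw [ha.L_eq] at hacc
    linarith
  have h1' := mul_le_mul_of_nonneg_left h1 hA'.le
  have h2' := mul_le_mul_of_nonneg_left h2 hA'.le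
  have e2 : a.A * (a.α / (2 * a.A) * ε) = a.α * ε / 2 := by field_simp
  have e3 : a.A * (P.M ^ 2 / (2 * L)) = P.M ^ 2 * a.α ^ 2 / 2 := by rw [← hLα]; field_simp
  rw [mul_add, mul_add _ _ (P.M ^ 2 / (2 * L)), e1, e3] at h1'
  rw [mul_add, mul_add _ _ (a.α / (2 * a.A) * ε), e1, e2] at h2'
  have e4 : ε * (ε / (8 * P.M ^ 2)) = ε ^ 2 / (8 * P.M ^ 2) := by ring
  rw [mul_sub, e4]
  rcases le_total ε (P.M ^ 2 * a.α) with hc | hc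
  · have : ε ^ 2 / (8 * P.M ^ 2) ≤ a.α * ε / 8 := by
      rw [div_le_div_iff₀ (by positivity) (by positivity)]
      have := mul_le_mul_of_nonneg_left hc hε.le
      linarith
    linarith
  -- After clearing denominators this is `(ε - M² α)(ε - 4 M² α) ≤ 0`, which is where the lower
  -- bound on the step size enters.
  · have : ε ^ 2 / (8 * P.M ^ 2) ≤ 5 / 8 * (a.α * ε) - P.M ^ 2 * a.α ^ 2 / 2 := by
      rw [div_le_iff₀ (by positivity)]
      have := mul_nonneg (sub_nonneg.2 hα4) (sub_nonneg.2 hc)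
      linarith
    linarith

end Attempt

/-! ### The estimating sequence -/

/-- The invariants of the method after `k` iterations. -/
structure Invariant (P : Model V E O D Pu Ag Mo) (h : LinkVec E → ℝ) (ε : ℝ) (k : ℕ)
    (s : State E) : Prop where
  L_pos : 0 < s.L
  A_nonneg : 0 ≤ s.A
  L_le : (s.A = 0 ∧ s.L * ε ≤ P.M ^ 2) ∨ s.L * ε ^ 2 ≤ 16 * (P.M ^ 2) ^ 2 * s.A
  t_mem : s.t ∈ P.dom
  u_mem : s.u ∈ P.dom
  u_min : IsMinOn s.φ P.dom s.u
  convex : ConvexOn ℝ P.dom fun t => s.φ t - 1 / 2 * ‖t‖ ^ 2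
  A_ge : k * ε ≤ 4 * P.M ^ 2 * s.A
  A_ge' : k * ε ≤ 3 * P.M ^ 2 * s.A + ε
  estimate : s.A * (P.phi3 s.t + h s.t) ≤
    s.φ s.u + ε * (7 / 8 * s.A - k * (ε / (8 * P.M ^ 2)))

variable {h : LinkVec E → ℝ} {ε L₀ : ℝ}

theorem invariant_init (hε : 0 < ε) (hL₀ : 0 < L₀) (hL₀M : L₀ * ε ≤ P.M ^ 2)
    (a : ℕ → Attempt E O D Pu Ag Mo) : P.Invariant h ε 0 (P.state h L₀ a 0) := by
  have hmem : P.tbar ∈ P.dom := fun _ => le_rfl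
  refine ⟨hL₀, le_rfl, Or.inl ⟨rfl, hL₀M⟩, hmem, hmem, ?_, ?_, ?_, ?_, ?_⟩
  · intro t _
    simp [state]
  · refine ⟨dom_convex, fun x _ y _ r s _ _ hrs => le_of_eq ?_⟩
    have e : ∀ t : LinkVec E, 1 / 2 * ‖t - P.tbar‖ ^ 2 - 1 / 2 * ‖t‖ ^ 2 =
        1 / 2 * ‖P.tbar‖ ^ 2 - inner ℝ t P.tbar := fun t => by
      rw [norm_sub_sq_real]; ring
    simp only [state, e, inner_add_left, real_inner_smul_left, smul_eq_mul]
    linear_combination -(1 / 2 * ‖P.tbar‖ ^ 2) * hrs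
  · simp [state]
  · simp [state, hε.le]
  · simp [state]

/-- The new estimate combines quadratic growth of `φ` at `u`, the model as a lower bound of `phi3`
at the old `t`, and convexity of `h`. The growth term pays exactly for the quadratic term of the
test. -/
theorem Invariant.step (hh : ConvexOn ℝ Set.univ h) (hε : 0 < ε) (hM : 0 < P.M) {k : ℕ}
    {s : State E} (hs : P.Invariant h ε k s) {a : Attempt E O D Pu Ag Mo}
    (hls : P.LineSearch h ε s a) :
    P.Invariant h ε (k + 1)
      { L := a.L, A := a.A, t := a.t, u := a.u, φ := P.nextPhi h s a } := by
  obtain ⟨hL, ha, hacc, hα4, hα3⟩ := hls.spec hε hM hs.L_pos hs.A_nonneg hs.L_le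
  have hα := ha.α_pos hL
  have hA0 := hs.A_nonneg
  have hLα := ha.mul_sq_eq hL hA0
  have hAeq := ha.A_eq
  rw [← hAeq] at hLα
  have hA' : 0 < a.A := by rw [← hLα]; positivity
  have hq : 0 < P.M ^ 2 := by positivity
  have hw : a.α / a.A + s.A / a.A = 1 := by rw [← add_div, add_comm, ← hAeq, div_self hA'.ne']
  have ht : a.t = (a.α / a.A) • a.u + (s.A / a.A) • s.t := by
    rw [ha.t_eq, smul_add, smul_smul, smul_smul]; ring_nf
  have hα0 : 0 ≤ a.α / a.A := by positivity
  have hA0' : 0 ≤ s.A / a.A := by positivity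
  refine ⟨hL, hA'.le, Or.inr ?_, ?_, ha.u_mem, ha.u_min, ?_, ?_, ?_, ?_⟩
  · change a.L * ε ^ 2 ≤ 16 * (P.M ^ 2) ^ 2 * a.A
    have h1 : ε ^ 2 ≤ (4 * P.M ^ 2 * a.α) ^ 2 := pow_le_pow_left₀ hε.le hα4 2
    have h2 := mul_le_mul_of_nonneg_left h1 hL.le
    rw [← hLα]
    linarith
  · change a.t ∈ P.dom
    rw [ht]
    exact dom_convex ha.u_mem hs.t_mem hα0 hA0' hw
  · have hc : ConvexOn ℝ P.dom (P.linModel a + h) :=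
      ((linModel_convex a).add hh).subset (Set.subset_univ _) dom_convex
    refine (hs.convex.add (hc.smul hα.le)).congr fun t _ => ?_
    simp only [nextPhi, Pi.add_apply, smul_eq_mul]
    ring
  · change ((k + 1 : ℕ) : ℝ) * ε ≤ 4 * P.M ^ 2 * a.A
    push_cast
    rw [hAeq]
    linarith [hs.A_ge]
  · change ((k + 1 : ℕ) : ℝ) * ε ≤ 3 * P.M ^ 2 * a.A + ε
    push_cast
    rw [hAeq]
    -- While `A` is small only the constant 4 is available, but then `k ≤ 3` and the extra `ε`
    -- absorbs the difference, since `k ≤ 3/4 (k + 1)`.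
    by_cases hbig : ε ≤ P.M ^ 2 * s.A
    · linarith [hs.A_ge', hα3 hbig]
    · have h4 : (k : ℝ) * ε < 4 * ε := by linarith [hs.A_ge]
      have h3 : (k : ℝ) ≤ 3 := by
        have : k < 4 := by exact_mod_cast lt_of_mul_lt_mul_right h4 hε.le
        exact_mod_cast Nat.lt_succ_iff.1 this
      have := mul_le_mul_of_nonneg_right h3 hε.le
      linarith [hs.A_ge]
  · change a.A * (P.phi3 a.t + h a.t) ≤ P.nextPhi h s a a.u +
      ε * (7 / 8 * a.A - ((k + 1 : ℕ) : ℝ) * (ε / (8 * P.M ^ 2)))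
    have h1 := add_half_norm_sq_le_of_isMinOn hs.convex hs.u_mem ha.u_mem hs.u_min
    have h2 := ha.accepted_upper hL hA0 hε hM hacc hα4
    have h3 := mul_le_mul_of_nonneg_left (ha.linModel_le s.t) hA0
    have h4 : a.A * P.linModel a a.t = a.α * P.linModel a a.u + s.A * P.linModel a s.t := by
      rw [ht, linModel_combo a hw]
      field_simp
    have h5 : a.A * h a.t ≤ a.α * h a.u + s.A * h s.t := by
      have := mul_le_mul_of_nonneg_left
        (hh.2 (Set.mem_univ a.u) (Set.mem_univ s.t) hα0 hA0' hw) hA'.le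
      rw [← ht] at this
      refine this.trans_eq ?_
      simp only [smul_eq_mul]
      field_simp
    -- Similar triangles: `t - y` is `u^{k+1} - u^k` scaled by `α / A`, and `L α² = A`.
    have h6 : a.A * (a.L / 2 * ‖a.t - a.y‖ ^ 2) = 1 / 2 * ‖a.u - s.u‖ ^ 2 := by
      have : a.t - a.y = (a.α / a.A) • (a.u - s.u) := by
        rw [ht, ha.y_eq, smul_add, smul_smul, smul_smul, smul_sub]
        ring_nf
        abel
      rw [this, norm_smul, mul_pow, Real.norm_eq_abs, sq_abs, div_pow]
      have : a.A * (a.L / 2 * (a.α ^ 2 / a.A ^ 2 * ‖a.u - s.u‖ ^ 2)) =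
          (a.L * a.α ^ 2) / a.A * (1 / 2 * ‖a.u - s.u‖ ^ 2) := by field_simp
      rw [this, hLα, div_self hA'.ne', one_mul]
    have h7 := hs.estimate
    unfold nextPhi
    push_cast
    have h8 : ε * (7 / 8 * a.A - (k + 1) * (ε / (8 * P.M ^ 2))) =
        ε * (7 / 8 * s.A - k * (ε / (8 * P.M ^ 2))) + ε * (7 / 8 * a.α - ε / (8 * P.M ^ 2)) := by
      rw [hAeq]; ring
    rw [h8]
    linarith

theorem IsRun.invariant {K : ℕ} {a : ℕ → Attempt E O D Pu Ag Mo} (hrun : P.IsRun h ε L₀ K a)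
    (hh : ConvexOn ℝ Set.univ h) (hε : 0 < ε) (hM : 0 < P.M) (hL₀ : 0 < L₀)
    (hL₀M : L₀ * ε ≤ P.M ^ 2) :
    ∀ k ≤ K, P.Invariant h ε k (P.state h L₀ a k)
  | 0, _ => invariant_init hε hL₀ hL₀M a
  | k + 1, hk => (hrun.invariant hh hε hM hL₀ hL₀M k (Nat.le_of_succ_le hk)).step hh hε hM
      (hrun k hk)

theorem state_φ (a : ℕ → Attempt E O D Pu Ag Mo) (t : LinkVec E) : ∀ k : ℕ,
    (P.state h L₀ a k).φ t = 1 / 2 * ‖t - P.tbar‖ ^ 2 +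
      ∑ n ∈ Finset.range k, (a n).α * (P.linModel (a n) t + h t)
  | 0 => by simp [state]
  | k + 1 => by
    rw [Finset.sum_range_succ, ← add_assoc, ← state_φ a t k]
    rfl

/-! ### The averaged primal point -/

section Average

variable {ι : Type*} {S : Finset ι} {w : ι → ℝ} {d : ι → ModeTrips O D Pu Ag Mo}
  {f : ι → ModeFlow E Mo}

theorem isConsistent_sum (hw : ∀ k ∈ S, 0 ≤ w k) (hw1 : ∑ k ∈ S, w k = 1)
    (hc : ∀ k ∈ S, P.IsConsistent (d k) (f k)) :
    P.IsConsistent (∑ k ∈ S, w k • d k) (∑ k ∈ S, w k • f k) := by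
  have := P.isConsistent_convex.sum_mem hw hw1 (z := fun k => (d k, f k)) hc
  simpa only [Set.mem_ofPred_eq, Prod.fst_sum, Prod.snd_sum, Prod.smul_mk] using this

theorem travelCost_sum (t : LinkVec E) :
    P.travelCost t (∑ k ∈ S, w k • f k) = ∑ k ∈ S, w k * P.travelCost t (f k) := by
  simp only [travelCost, Finset.sum_apply, Pi.smul_apply, map_sum, map_smul, smul_eq_mul,
    Finset.mul_sum]
  rw [Finset.sum_comm]

theorem H_sum_le (hw : ∀ k ∈ S, 0 ≤ w k) (hw1 : ∑ k ∈ S, w k = 1)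
    (hc : ∀ k ∈ S, P.IsConsistent (d k) (f k)) :
    P.H (∑ k ∈ S, w k • d k) ≤ ∑ k ∈ S, w k * P.H (d k) :=
  P.H_convex.map_sum_le hw hw1 fun k hk => (hc k hk).nonneg

end Average

/-- The outcome of the method: the recovered point satisfies the network constraints and
majorizes the values of the dual objective up to the accumulated errors. -/
theorem IsRun.outcome {K : ℕ} {a : ℕ → Attempt E O D Pu Ag Mo} (hrun : P.IsRun h ε L₀ K a)
    (hh : ConvexOn ℝ Set.univ h) (hε : 0 < ε) (hM : 0 < P.M) (hL₀ : 0 < L₀)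
    (hL₀M : L₀ * ε ≤ P.M ^ 2) (hK : 1 ≤ K) :
    P.IsConsistent (P.dhat h L₀ a K) (P.fhat h L₀ a K) ∧
    ∀ t ∈ P.dom, (P.state h L₀ a K).A * (P.phi3 (P.state h L₀ a K).t + h (P.state h L₀ a K).t) ≤
      1 / 2 * ‖t - P.tbar‖ ^ 2 + (P.state h L₀ a K).A *
        (h t - P.travelCost t (P.fhat h L₀ a K) - P.H (P.dhat h L₀ a K)) +
      ε * (7 / 8 * (P.state h L₀ a K).A - K * (ε / (8 * P.M ^ 2))) := by
  have hinv := hrun.invariant hh hε hM hL₀ hL₀M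
  have hspec : ∀ k < K, 0 < (a k).L ∧ P.IsAttempt h ε (P.state h L₀ a k) (a k).L (a k) :=
    fun k hk => by
      have hi := hinv k hk.le
      obtain ⟨h1, h2, _⟩ := (hrun k hk).spec hε hM hi.L_pos hi.A_nonneg hi.L_le
      exact ⟨h1, h2⟩
  have hα : ∀ k ∈ Finset.range K, 0 < (a k).α := fun k hk =>
    (hspec k (Finset.mem_range.1 hk)).2.α_pos (hspec k (Finset.mem_range.1 hk)).1
  have hsum : ∀ k ≤ K, (P.state h L₀ a k).A = ∑ n ∈ Finset.range k, (a n).α := by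
    intro k
    induction k with
    | zero => intro _; simp [state]
    | succ k ih =>
      intro hk
      rw [Finset.sum_range_succ, ← ih (Nat.le_of_succ_le hk)]
      exact (hspec k hk).2.A_eq
  set A := (P.state h L₀ a K).A with hAdef
  have hAsum : A = ∑ n ∈ Finset.range K, (a n).α := hsum K le_rfl
  have hApos : 0 < A := by
    rw [hAsum]
    exact Finset.sum_pos hα ⟨0, Finset.mem_range.2 hK⟩
  have hw : ∀ k ∈ Finset.range K, 0 ≤ 1 / A * (a k).α := fun k hk => by
    have := hα k hk
    positivity
  have hw1 : ∑ k ∈ Finset.range K, 1 / A * (a k).α = 1 := by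
    rw [← Finset.mul_sum, ← hAsum, one_div_mul_cancel hApos.ne']
  have hc : ∀ k ∈ Finset.range K, P.IsConsistent (P.modalSplit (a k).y (a k).dy) (a k).fy :=
    fun k hk => P.isConsistent_modalSplit (hspec k (Finset.mem_range.1 hk)).2.dy_sol.1
      (hspec k (Finset.mem_range.1 hk)).2.fy_flow
  have hd : P.dhat h L₀ a K =
      ∑ k ∈ Finset.range K, (1 / A * (a k).α) • P.modalSplit (a k).y (a k).dy := by
    simp only [dhat, Finset.smul_sum, smul_smul, hAdef]
  have hf : P.fhat h L₀ a K = ∑ k ∈ Finset.range K, (1 / A * (a k).α) • (a k).fy := by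
    simp only [fhat, Finset.smul_sum, smul_smul, hAdef]
  refine ⟨?_, fun t ht => ?_⟩
  · rw [hd, hf]
    exact isConsistent_sum hw hw1 hc
  · have hest := (hinv K le_rfl).estimate
    have hmin : (P.state h L₀ a K).φ (P.state h L₀ a K).u ≤ (P.state h L₀ a K).φ t :=
      (hinv K le_rfl).u_min ht
    rw [state_φ (t := t)] at hmin
    have hlin : ∑ n ∈ Finset.range K, (a n).α * (P.linModel (a n) t + h t) ≤
        A * (h t - P.travelCost t (P.fhat h L₀ a K) - P.H (P.dhat h L₀ a K)) := by
      have hH : P.H (P.dhat h L₀ a K) ≤ _ := hd ▸ H_sum_le hw hw1 hc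
      have h1 := mul_le_mul_of_nonneg_left hH hApos.le
      have h2 : A * P.travelCost t (P.fhat h L₀ a K) =
          ∑ k ∈ Finset.range K, (a k).α * P.travelCost t (a k).fy := by
        rw [hf, travelCost_sum, Finset.mul_sum]
        refine Finset.sum_congr rfl fun k _ => ?_
        field_simp
      have h3 : A * ∑ k ∈ Finset.range K, 1 / A * (a k).α * P.H (P.modalSplit (a k).y (a k).dy) =
          ∑ k ∈ Finset.range K, (a k).α * P.H (P.modalSplit (a k).y (a k).dy) := by
        rw [Finset.mul_sum]
        refine Finset.sum_congr rfl fun k _ => ?_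
        field_simp
      have h4 : ∑ n ∈ Finset.range K, (a n).α * (P.linModel (a n) t + h t) = A * h t -
          ∑ k ∈ Finset.range K, (a k).α * P.travelCost t (a k).fy -
          ∑ k ∈ Finset.range K, (a k).α * P.H (P.modalSplit (a k).y (a k).dy) := by
        rw [hAsum, Finset.sum_mul, ← Finset.sum_sub_distrib, ← Finset.sum_sub_distrib]
        refine Finset.sum_congr rfl fun k hk => ?_
        rw [(hspec k (Finset.mem_range.1 hk)).2.linModel_eq]
        ring
      rw [h4]
      linarith
    linarith

end Model

/-! ### From the estimate to the two duality gaps. -/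

/-- The bound on the capacity violation `r` at distance `R` of the dual solution, the accumulated
weight being `A`. -/
theorem mul_le_two_mul_of_sq_le {A r R ε : ℝ} (hA : 0 < A) (hR : 0 ≤ R)
    (hAR : 5 / 4 * R ^ 2 ≤ ε * A) (h : (A * r - R) ^ 2 ≤ 7 / 4 * (ε * A)) : r * R ≤ 2 * ε := by
  by_contra hlt
  push Not at hlt
  have h1 : 2 * (ε * A) < A * r * R := by
    have := mul_lt_mul_of_pos_left hlt hA
    linarith
  set p := A * r with hp
  rcases hR.eq_or_lt with h0 | h0
  · rw [← h0] at h1 hAR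
    linarith
  · have h2 : 5 / 2 * R < p := by
      have : (5 / 2 * R) * R < p * R := by linarith
      exact lt_of_mul_lt_mul_right this hR
    -- The hypotheses give `p² - 23/8 p R + R² < 0`, while this product is `p² - 23/8 p R + 15/16
    -- R²`.
    have h3 : 0 < (p - 5 / 2 * R) * (p - 3 / 8 * R) := mul_pos (by linarith) (by linarith)
    have h4 : 0 < R ^ 2 := by positivity
    linarith

namespace Model

variable {V E O D Pu Ag Mo : Type*} [Fintype V] [Fintype E] [Fintype O] [Fintype D]
  [Fintype Pu] [Fintype Ag] [Fintype Mo] {P : Model V E O D Pu Ag Mo}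

/-- The point `t` is free, since its two occurrences cancel; it is later set to the test point of
the estimate. -/
theorem gap_eq (σ : E → ℝ → ℝ) (h : LinkVec E → ℝ) (L₀ : ℝ) (a : ℕ → Attempt E O D Pu Ag Mo)
    (K : ℕ) (t : LinkVec E) : P.gap σ h L₀ a K =
      ∑ e, σ e (totalFlow (P.fhat h L₀ a K) e) - inner ℝ (totalFlow (P.fhat h L₀ a K)) t +
      (P.travelCost t (P.fhat h L₀ a K) + P.H (P.dhat h L₀ a K)) +
      (P.phi3 (P.state h L₀ a K).t + h (P.state h L₀ a K).t) := by
  rw [gap, P3, Psi, dual, travelCost_eq, Finset.sum_add_distrib]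
  ring

/-! ### The Beckmann model -/

section Beckmann

variable {ρ μ : ℝ}

theorem bpr_continuous (hμ : 0 < μ) (e : E) : Continuous (P.bpr ρ μ e) := by
  have : Continuous fun z : ℝ => (z / P.fbar e) ^ (1 / μ) :=
    (continuous_id.div_const _).rpow_const fun _ => Or.inr (by positivity)
  unfold bpr
  fun_prop

theorem bpr_mono (hρ : 0 < ρ) (hμ : 0 < μ) (e : E) {z z' : ℝ} (hz : 0 ≤ z) (hzz : z ≤ z') :
    P.bpr ρ μ e z ≤ P.bpr ρ μ e z' := by
  have := P.tbar_pos e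
  have := P.fbar_pos e
  unfold bpr
  gcongr

theorem tbar_le_bpr (hρ : 0 < ρ) (e : E) {z : ℝ} (hz : 0 ≤ z) :
    P.tbar e ≤ P.bpr ρ μ e z := by
  have h1 := P.tbar_pos e
  have h2 := P.fbar_pos e
  have : 0 ≤ P.tbar e * (ρ * (z / P.fbar e) ^ (1 / μ)) := by positivity
  unfold bpr
  linarith

theorem sigmaB_tangent (hρ : 0 < ρ) (hμ : 0 < μ) (e : E) {z z' : ℝ} (hz : 0 ≤ z) (hz' : 0 ≤ z') :
    P.sigmaB ρ μ e z + P.bpr ρ μ e z * (z' - z) ≤ P.sigmaB ρ μ e z' := by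
  have hint : ∀ x y : ℝ, IntervalIntegrable (P.bpr ρ μ e) MeasureTheory.volume x y := fun x y =>
    (bpr_continuous hμ e).intervalIntegrable x y
  have hsub : P.sigmaB ρ μ e z' - P.sigmaB ρ μ e z = ∫ s in z..z', P.bpr ρ μ e s :=
    intervalIntegral.integral_interval_sub_left (hint 0 z') (hint 0 z)
  rcases le_total z z' with hle | hle
  · have := intervalIntegral.integral_mono_on hle
      (intervalIntegrable_const (c := P.bpr ρ μ e z)) (hint z z')
      fun s hs => bpr_mono hρ hμ e hz hs.1
    rw [intervalIntegral.integral_const, smul_eq_mul] at this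
    linarith
  · have := intervalIntegral.integral_mono_on hle (hint z' z)
      (intervalIntegrable_const (c := P.bpr ρ μ e z))
      fun s hs => bpr_mono hρ hμ e (hz'.trans hs.1) hs.2
    rw [intervalIntegral.integral_const, smul_eq_mul] at this
    rw [intervalIntegral.integral_symm] at hsub
    linarith

theorem conj_le (hρ : 0 < ρ) (hμ : 0 < μ) (e : E) {τ z₀ z : ℝ} (hz₀ : 0 ≤ z₀) (hz : 0 ≤ z)
    (hτ : τ ≤ P.bpr ρ μ e z₀) :
    τ * z - P.sigmaB ρ μ e z ≤ P.bpr ρ μ e z₀ * z₀ - P.sigmaB ρ μ e z₀ := by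
  have h1 := sigmaB_tangent (P := P) hρ hμ e hz₀ hz
  have h2 := mul_le_mul_of_nonneg_right hτ hz
  linarith

/-- Ensures that `sSup` in `hB` is a true supremum. The witness is the flow whose BPR cost is `tbar
e + |τ|`, and a tangent there bounds the conjugate. -/
theorem conj_bddAbove (hρ : 0 < ρ) (hμ : 0 < μ) (e : E) (τ : ℝ) :
    BddAbove ((fun z => τ * z - P.sigmaB ρ μ e z) '' Set.Ici 0) := by
  have h1 := P.tbar_pos e
  have h2 := P.fbar_pos e
  set x := |τ| / (P.tbar e * ρ) with hx
  have hx0 : 0 ≤ x := by positivity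
  have hz₀ : 0 ≤ P.fbar e * x ^ μ := by positivity
  have hτ : τ ≤ P.bpr ρ μ e (P.fbar e * x ^ μ) := by
    have : P.bpr ρ μ e (P.fbar e * x ^ μ) = P.tbar e + |τ| := by
      rw [bpr, mul_div_cancel_left₀ _ h2.ne', ← Real.rpow_mul hx0, mul_one_div_cancel hμ.ne',
        Real.rpow_one, hx]
      field_simp
    rw [this]
    linarith [le_abs_self τ]
  refine ⟨P.bpr ρ μ e (P.fbar e * x ^ μ) * (P.fbar e * x ^ μ) -
    P.sigmaB ρ μ e (P.fbar e * x ^ μ), ?_⟩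
  rintro _ ⟨z, hz, rfl⟩
  exact conj_le hρ hμ e hz₀ hz hτ

theorem le_hB (hρ : 0 < ρ) (hμ : 0 < μ) (t : LinkVec E) {F : LinkVec E} (hF : ∀ e, 0 ≤ F e) :
    inner ℝ F t - ∑ e, P.sigmaB ρ μ e (F e) ≤ P.hB ρ μ t := by
  rw [inner_eq_sum, ← Finset.sum_sub_distrib]
  refine Finset.sum_le_sum fun e _ => le_csSup (conj_bddAbove hρ hμ e (t e)) ⟨F e, hF e, ?_⟩
  simp only [mul_comm]

theorem hB_le (hρ : 0 < ρ) (hμ : 0 < μ) {t F : LinkVec E} (hF : ∀ e, 0 ≤ F e)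
    (ht : ∀ e, t e = P.bpr ρ μ e (F e)) :
    P.hB ρ μ t ≤ inner ℝ F t - ∑ e, P.sigmaB ρ μ e (F e) := by
  rw [inner_eq_sum, ← Finset.sum_sub_distrib]
  refine Finset.sum_le_sum fun e _ => csSup_le (Set.nonempty_Ici.image _) ?_
  rintro _ ⟨z, hz, rfl⟩
  have := conj_le (P := P) hρ hμ e (hF e) hz (ht e).le
  rw [mul_comm (F e), ht e]
  rwa [ht e] at this

theorem hB_convex (hρ : 0 < ρ) (hμ : 0 < μ) : ConvexOn ℝ Set.univ (P.hB ρ μ) := by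
  refine ⟨convex_univ, fun x _ y _ a b ha hb hab => ?_⟩
  simp only [hB, smul_eq_mul, Finset.mul_sum, ← Finset.sum_add_distrib]
  refine Finset.sum_le_sum fun e _ => csSup_le (Set.nonempty_Ici.image _) ?_
  rintro _ ⟨z, hz, rfl⟩
  have h1 := mul_le_mul_of_nonneg_left (le_csSup (conj_bddAbove (P := P) hρ hμ e (x e)) ⟨z, hz, rfl⟩) ha
  have h2 := mul_le_mul_of_nonneg_left (le_csSup (conj_bddAbove (P := P) hρ hμ e (y e)) ⟨z, hz, rfl⟩) hb
  refine le_trans (le_of_eq ?_) (add_le_add h1 h2)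
  simp only [PiLp.add_apply, PiLp.smul_apply, smul_eq_mul]
  linear_combination (P.sigmaB ρ μ e z) * hab

theorem norm_bpr_sub_sq_le (hρ : 0 < ρ) (hμ : 0 < μ) {t F : LinkVec E} (hF : ∀ e, 0 ≤ F e)
    (hFN : ∀ e, F e ≤ P.N) (ht : ∀ e, t e = P.bpr ρ μ e (F e)) :
    ‖t - P.tbar‖ ^ 2 ≤ P.Rtilde ρ μ ^ 2 := by
  have hN := P.N_nonneg
  have hsum : 0 ≤ ∑ e, P.tbar e ^ 2 / P.fbar e ^ (2 / μ) := Finset.sum_nonneg fun e _ => by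
    have := P.fbar_pos e
    positivity
  rw [Rtilde, Real.sq_sqrt (by positivity), EuclideanSpace.norm_sq_eq, Finset.mul_sum]
  refine Finset.sum_le_sum fun e _ => ?_
  have h1 := P.tbar_pos e
  have h2 := P.fbar_pos e
  have h3 := hF e
  have e1 : (t - P.tbar) e = P.tbar e * (ρ * (F e / P.fbar e) ^ (1 / μ)) := by
    rw [PiLp.sub_apply, ht e, bpr]; ring
  have e2 : ((P.N / P.fbar e) ^ (1 / μ)) ^ 2 = P.N ^ (2 / μ) / P.fbar e ^ (2 / μ) := by
    rw [← Real.rpow_mul_natCast (by positivity), ← Real.div_rpow hN h2.le]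
    congr 1
    push_cast
    ring
  rw [e1, Real.norm_eq_abs, sq_abs]
  calc (P.tbar e * (ρ * (F e / P.fbar e) ^ (1 / μ))) ^ 2
      ≤ (P.tbar e * (ρ * (P.N / P.fbar e) ^ (1 / μ))) ^ 2 := by
        gcongr
        exact hFN e
    _ = ρ ^ 2 * P.N ^ (2 / μ) * (P.tbar e ^ 2 / P.fbar e ^ (2 / μ)) := by
        rw [mul_pow, mul_pow, e2]; ring

end Beckmann

/-! ### The stable dynamics model -/

theorem hSD_convex : ConvexOn ℝ Set.univ P.hSD := by
  refine ⟨convex_univ, fun x _ y _ a b _ _ hab => le_of_eq ?_⟩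
  simp only [hSD, inner_sub_left, inner_add_left, real_inner_smul_left, smul_eq_mul]
  linear_combination (inner ℝ P.tbar P.fbar) * hab

theorem inner_le_inner_excess (f : ModeFlow E Mo) {t : LinkVec E} (ht : t ∈ P.dom) :
    inner ℝ (totalFlow f - P.fbar) (t - P.tbar) ≤ inner ℝ (P.excess f) (t - P.tbar) := by
  rw [inner_eq_sum, inner_eq_sum]
  refine Finset.sum_le_sum fun e _ => mul_le_mul_of_nonneg_right (le_max_left _ _) ?_
  exact sub_nonneg.2 (ht e)

theorem inner_excess (f : ModeFlow E Mo) :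
    inner ℝ (totalFlow f - P.fbar) (P.excess f) = ‖P.excess f‖ ^ 2 := by
  rw [inner_eq_sum, EuclideanSpace.norm_sq_eq]
  refine Finset.sum_congr rfl fun e _ => ?_
  simp only [excess, PiLp.sub_apply, Real.norm_eq_abs, sq_abs]
  rcases le_total (totalFlow f e - P.fbar e) 0 with h | h
  · rw [max_eq_right h]; simp
  · rw [max_eq_left h]; ring

theorem excess_nonneg (f : ModeFlow E Mo) (e : E) : 0 ≤ P.excess f e := le_max_right _ _

/-! ### Final rates for both models. -/

section Rates

variable {ε L₀ : ℝ} {K : ℕ} {a : ℕ → Attempt E O D Pu Ag Mo}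

theorem four_mul_sq_le {R : ℝ} (hε : 0 < ε) (hK : 4 * (P.M * R / ε) ^ 2 ≤ (K : ℝ)) :
    4 * (P.M ^ 2 * R ^ 2) ≤ K * ε ^ 2 := by
  rw [div_pow, mul_pow, ← mul_div_assoc, div_le_iff₀ (by positivity)] at hK
  exact hK

theorem half_sq_le {R : ℝ} (hε : 0 < ε) (hM : 0 < P.M)
    (hK : 4 * (P.M * R / ε) ^ 2 ≤ (K : ℝ)) : 1 / 2 * R ^ 2 ≤ ε * (K * (ε / (8 * P.M ^ 2))) := by
  have h1 := four_mul_sq_le hε hK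
  have h2 : ε * (K * (ε / (8 * P.M ^ 2))) = K * ε ^ 2 / (8 * P.M ^ 2) := by ring
  rw [h2, le_div_iff₀ (by positivity)]
  linarith

theorem IsRun.A_pos {h : LinkVec E → ℝ} (hrun : P.IsRun h ε L₀ K a)
    (hh : ConvexOn ℝ Set.univ h) (hε : 0 < ε) (hM : 0 < P.M) (hL₀ : 0 < L₀)
    (hL₀M : L₀ * ε ≤ P.M ^ 2) (hK : 1 ≤ K) : 0 < (P.state h L₀ a K).A := by
  have h1 := (hrun.invariant hh hε hM hL₀ hL₀M K le_rfl).A_ge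
  have h2 : 0 < (K : ℝ) * ε := mul_pos (by exact_mod_cast hK) hε
  exact pos_of_mul_pos_right (h2.trans_le h1) (by positivity)

theorem IsRun.beckmann_gap {ρ μ : ℝ} (hρ : 0 < ρ) (hμ : 0 < μ)
    (hrun : P.IsRun (P.hB ρ μ) ε L₀ K a) (hε : 0 < ε) (hM : 0 < P.M) (hL₀ : 0 < L₀)
    (hL₀M : L₀ * ε ≤ P.M ^ 2) (hK : 1 ≤ K)
    (hKR : 4 * (P.M * P.Rtilde ρ μ / ε) ^ 2 ≤ (K : ℝ)) :
    0 ≤ P.gap (P.sigmaB ρ μ) (P.hB ρ μ) L₀ a K ∧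
      P.gap (P.sigmaB ρ μ) (P.hB ρ μ) L₀ a K ≤ ε := by
  have hconv := hB_convex (P := P) hρ hμ
  have hA := hrun.A_pos hconv hε hM hL₀ hL₀M hK
  obtain ⟨hc, hbound⟩ := hrun.outcome hconv hε hM hL₀ hL₀M hK
  constructor
  · rw [gap_eq _ _ _ _ _ (P.state (P.hB ρ μ) L₀ a K).t]
    linarith [hc.neg_phi3_le (P.state (P.hB ρ μ) L₀ a K).t,
      le_hB (P := P) hρ hμ (P.state (P.hB ρ μ) L₀ a K).t hc.flow_nonneg]
  · set F := totalFlow (P.fhat (P.hB ρ μ) L₀ a K) with hF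
    -- Link costs at the recovered flow: the Fenchel terms of the gap then cancel, leaving the prox
    -- term and the accumulated error.
    set t : LinkVec E := WithLp.toLp 2 fun e => P.bpr ρ μ e (F e) with ht
    have hte : ∀ e, t e = P.bpr ρ μ e (F e) := fun _ => rfl
    have hmem : t ∈ P.dom := fun e => tbar_le_bpr hρ e (hc.flow_nonneg e)
    have h1 := hbound t hmem
    have h2 := norm_bpr_sub_sq_le hρ hμ hc.flow_nonneg hc.flow_le hte
    have h3 := half_sq_le hε hM hKR
    have h4 := mul_le_mul_of_nonneg_left (hB_le (P := P) hρ hμ hc.flow_nonneg hte) hA.le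
    refine le_of_mul_le_mul_left ?_ hA
    rw [gap_eq _ _ _ _ _ t]
    have := mul_pos hA hε
    linarith

theorem IsRun.stableDynamics_gap {tstar : LinkVec E} (hmem : tstar ∈ P.dom)
    (hmax : IsMaxOn (P.dual P.hSD) P.dom tstar)
    (hrun : P.IsRun P.hSD ε L₀ K a) (hε : 0 < ε) (hM : 0 < P.M) (hL₀ : 0 < L₀)
    (hL₀M : L₀ * ε ≤ P.M ^ 2) (hK : 1 ≤ K)
    (hKR : 4 * (P.M * ‖tstar - P.tbar‖ / ε) ^ 2 ≤ (K : ℝ)) :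
    0 ≤ P.gap P.sigmaSD P.hSD L₀ a K
        + inner ℝ (P.excess (P.fhat P.hSD L₀ a K)) (tstar - P.tbar) ∧
      P.gap P.sigmaSD P.hSD L₀ a K
        + inner ℝ (P.excess (P.fhat P.hSD L₀ a K)) (tstar - P.tbar) ≤ ε ∧
      ‖P.excess (P.fhat P.hSD L₀ a K)‖ * ‖tstar - P.tbar‖ ≤ 2 * ε := by
  have hA := hrun.A_pos hSD_convex hε hM hL₀ hL₀M hK
  have hinv := hrun.invariant hSD_convex hε hM hL₀ hL₀M K le_rfl
  obtain ⟨hc, hbound⟩ := hrun.outcome hSD_convex hε hM hL₀ hL₀M hK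
  set f := P.fhat P.hSD L₀ a K with hf
  set d := P.dhat P.hSD L₀ a K with hd
  set A := (P.state P.hSD L₀ a K).A with hAdef
  set tK := (P.state P.hSD L₀ a K).t with htK
  set x := P.excess f with hx
  set R := ‖tstar - P.tbar‖ with hR
  have hσ : ∑ e, P.sigmaSD e (totalFlow f e) = inner ℝ (totalFlow f) P.tbar := by
    rw [inner_eq_sum]; rfl
  have hlow : 0 ≤ P.gap P.sigmaSD P.hSD L₀ a K + inner ℝ x (tstar - P.tbar) := by
    have h1 : P.dual P.hSD tK ≤ P.dual P.hSD tstar := hmax hinv.t_mem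
    have h2 := hc.neg_phi3_le tstar
    have h3 := inner_le_inner_excess f hmem
    rw [inner_sub_left, inner_sub_right, real_inner_comm (tstar - P.tbar) P.fbar] at h3
    rw [gap_eq _ _ _ _ _ tstar, hσ]
    unfold dual at h1
    have h4 : P.hSD tstar = inner ℝ (tstar - P.tbar) P.fbar := rfl
    linarith
  have hup : A * P.gap P.sigmaSD P.hSD L₀ a K ≤
      -(1 / 2 * (A * ‖x‖) ^ 2) + ε * (7 / 8 * A - K * (ε / (8 * P.M ^ 2))) := by
    -- The multiplier `A` minimizes the prox term plus the linear term in the violation along the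
    -- ray from `tbar` in the direction `x`.
    have hmem' : P.tbar + A • x ∈ P.dom := fun e => by
      have := mul_nonneg hA.le (P.excess_nonneg f e)
      simp only [PiLp.add_apply, PiLp.smul_apply, smul_eq_mul]
      linarith
    have h1 := hbound _ hmem'
    have h2 : P.hSD (P.tbar + A • x) = A * inner ℝ P.fbar x := by
      rw [hSD, add_sub_cancel_left, real_inner_smul_left, real_inner_comm]
    have h3 := inner_excess (P := P) f
    rw [inner_sub_left] at h3
    rw [add_sub_cancel_left, norm_smul, Real.norm_eq_abs, abs_of_pos hA, h2] at h1
    rw [gap_eq _ _ _ _ _ (P.tbar + A • x), hσ, inner_add_right, real_inner_smul_right]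
    have h4 : A * (A * (inner ℝ (totalFlow f) x - inner ℝ P.fbar x)) = (A * ‖x‖) ^ 2 := by
      rw [h3]; ring
    linarith
  have hcs : inner ℝ x (tstar - P.tbar) ≤ ‖x‖ * R := real_inner_le_norm _ _
  have hRK := half_sq_le hε hM hKR
  have hcsA := mul_le_mul_of_nonneg_left hcs hA.le
  have hlowA := mul_nonneg hA.le hlow
  refine ⟨hlow, ?_, ?_⟩
  · refine le_of_mul_le_mul_left ?_ hA
    have := mul_pos hA hε
    -- The prox term, the Cauchy–Schwarz bound and the saving `R² / 2` complete the square `-(A ‖x‖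
    -- - R)² / 2`. The same square and `hlow` later bound the violation.
    linarith [sq_nonneg (A * ‖x‖ - R)]
  · have hR4 := four_mul_sq_le hε hKR
    have hq : 0 < P.M ^ 2 := by positivity
    -- For `K ≤ 32` the a priori bound `2 ‖x‖² ≤ M²` with `4 M² R² ≤ K ε²` already gives `‖x‖ R ≤ 2
    -- ε`. For larger `K` the growth of `A` with constant 3 yields `5/4 R² ≤ ε A`.
    rcases le_or_gt K 32 with hK32 | hK32
    · have h1 : (K : ℝ) ≤ 32 := by exact_mod_cast hK32
      have h2 := mul_le_mul_of_nonneg_right h1 (sq_nonneg ε)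
      have h3 := mul_le_mul_of_nonneg_right hc.excess_sq_le (sq_nonneg R)
      refine (abs_le_of_sq_le_sq' ?_ (by positivity)).2
      linarith
    · have h1 : (33 : ℝ) ≤ K := by exact_mod_cast hK32
      have h2 := hinv.A_ge'
      refine mul_le_two_mul_of_sq_le hA (norm_nonneg _) ?_ ?_
      · have h3 : 5 * (K * ε) ≤ 16 * (P.M ^ 2 * A) := by
          have := mul_le_mul_of_nonneg_right h1 hε.le
          linarith
        have h4 := mul_le_mul_of_nonneg_right h3 hε.le
        refine le_of_mul_le_mul_left ?_ hq
        linarith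
      · linarith

end Rates

end Model
end TrafficUSTM
end

theorem theorem1 {V E O D Pu Ag Mo : Type*} [Fintype V] [Fintype E] [Fintype O] [Fintype D]
    [Fintype Pu] [Fintype Ag] [Fintype Mo] (P : TrafficUSTM.Model V E O D Pu Ag Mo)
    (ε L₀ : ℝ) (hε : 0 < ε) (hL₀ : 0 < L₀) (hL₀M : L₀ ≤ P.M ^ 2 / ε) :
    -- Beckmann model
    (∀ ρ μ : ℝ, 0 < ρ → 0 < μ →
      ∀ (K : ℕ) (a : ℕ → TrafficUSTM.Attempt E O D Pu Ag Mo),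
        1 ≤ K → 4 * (P.M * P.Rtilde ρ μ / ε) ^ 2 ≤ (K : ℝ) →
        P.IsRun (P.hB ρ μ) ε L₀ K a →
        0 ≤ P.gap (P.sigmaB ρ μ) (P.hB ρ μ) L₀ a K ∧
        P.gap (P.sigmaB ρ μ) (P.hB ρ μ) L₀ a K ≤ ε) ∧
    -- stable dynamics model
    (∀ tstar ∈ P.dom, IsMaxOn (P.dual P.hSD) P.dom tstar →
      ∀ (K : ℕ) (a : ℕ → TrafficUSTM.Attempt E O D Pu Ag Mo),
        1 ≤ K → 4 * (P.M * ‖tstar - P.tbar‖ / ε) ^ 2 ≤ (K : ℝ) →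
        P.IsRun P.hSD ε L₀ K a →
        0 ≤ P.gap P.sigmaSD P.hSD L₀ a K
            + inner ℝ (P.excess (P.fhat P.hSD L₀ a K)) (tstar - P.tbar) ∧
        P.gap P.sigmaSD P.hSD L₀ a K
            + inner ℝ (P.excess (P.fhat P.hSD L₀ a K)) (tstar - P.tbar) ≤ ε ∧
        (0 < ‖tstar - P.tbar‖ →
          ‖P.excess (P.fhat P.hSD L₀ a K)‖ ≤ 2 * ε / ‖tstar - P.tbar‖)) := by
  have hLε : L₀ * ε ≤ P.M ^ 2 := (le_div_iff₀ hε).1 hL₀M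
  -- Positivity of `M` is forced by `0 < L₀ ≤ M² / ε`.
  have hM : 0 < P.M := by
    refine lt_of_le_of_ne TrafficUSTM.Model.M_nonneg fun h0 => ?_
    rw [← h0] at hLε
    have := mul_pos hL₀ hε
    norm_num at hLε
    linarith
  refine ⟨fun ρ μ hρ hμ K a hK hKR hrun => hrun.beckmann_gap hρ hμ hε hM hL₀ hLε hK hKR,
    fun tstar hmem hmax K a hK hKR hrun => ?_⟩
  obtain ⟨h1, h2, h3⟩ := hrun.stableDynamics_gap hmem hmax hε hM hL₀ hLε hK hKR
  exact ⟨h1, h2, fun hR => (le_div_iff₀ hR).2 h3⟩
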